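/- Let $K$ be a number field and let $d,n$ be integers with $d>1$ and $n\ge 0$. Then there is a Zariski dense subset $\mathcal H\subseteq K^d$ (that is, no nonzero polynomial in $d$ variables over $K$ vanishes on all of $\mathcal H$) such that for every $f(x)=x^d+c_{d-1}x^{d-1}+\dots+c_1x+c_0$ with $(c_0,\dots,c_{d-1})\in\mathcal H$ one has \[\operatorname{Gal}\bigl(K\bigl((f'\circ f^n)^{-1}(0)\bigr)/K\bigr)\;\cong\; S_{d-1}\bigl[[S_d]^n\bigr].\] Here $f'$ is the derivative of $f$, $f^n$ is the $n$-th iterate of $f$ under composition ($f^0(x)=x$), and $K((f'\circ f^n)^{-1}(0))$ is the field generated over $K$ by the roots of $f'\circ f^n$ in an algebraic closure of $K$, i.e. the splitting field of $f'\circ f^n$ over $K$. For a group $G$ and $m\ge 1$, $S_m[G]=G^m\rtimes S_m$ is the wreath product in which the symmetric group $S_m$ permutes the $m$ coordinates of $G^m$; $[S_d]^0$ is the trivial group and $[S_d]^{n+1}=S_d[[S_d]^n]$. -/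

import Mathlib

/-- A subset `S` of the affine space `K ^ ι` is Zariski dense if it meets every nonempty basic
open set: no nonzero polynomial vanishes identically on `S`. (Over an infinite field `K`, the set
`{x | p(x) ≠ 0}` is nonempty exactly when `p ≠ 0`.) -/
def ZariskiDense {K ι : Type*} [Field K] (S : Set (ι → K)) : Prop :=
  ∀ p : MvPolynomial ι K, p ≠ 0 → ∃ x ∈ S, MvPolynomial.eval x p ≠ 0

/-- The permutational wreath product `S_m[G] = G ^ m ⋊ S_m`, where the symmetric group acts by
permuting the coordinates: `(σ • v) i = v (σ⁻¹ i)`. -/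
abbrev SymWreath (m : ℕ) (G : Type) [Group G] : Type :=
  SemidirectProduct (Fin m → G) (Equiv.Perm (Fin m)) mulAutArrow

/-- The iterated wreath product of the symmetric group, as a bundled group: `[S_d]^0` is
trivial and `[S_d]^(n+1) = S_d[[S_d]^n]`. -/
def iteratedSymWreath (d : ℕ) : ℕ → GrpCat.{0}
  | 0 => GrpCat.of PUnit
  | n + 1 => GrpCat.of (SymWreath d (iteratedSymWreath d n))

/-- The monic polynomial `x^d + c_{d-1} x^{d-1} + ⋯ + c_1 x + c_0`. -/
noncomputable def monicOfCoeffs {K : Type*} [Field K] {d : ℕ} (c : Fin d → K) : Polynomial K :=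
  Polynomial.X ^ d + ∑ i : Fin d, Polynomial.C (c i) * Polynomial.X ^ (i : ℕ)

/-- The polynomial `f' ∘ f^n`, where `f^n` is the `n`-th iterate of `f` under composition and
`f^0 = x`. -/
noncomputable def derivCompIterate {K : Type*} [Field K] (f : Polynomial K) (n : ℕ) :
    Polynomial K :=
  (Polynomial.derivative f).comp (f.comp^[n] Polynomial.X)

/-!
The members of `H` are polynomials `f` with integer coefficients for which `f' = d g` with `g` monic
and integral. The Galois group acts on the tree of iterated preimages under `f` of the roots of `g`,
and it is the full wreath product as soon as, on every level, it is transitive, the stabilizer of a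
point of some fibre is transitive on the rest of that fibre, and some element acts as a
transposition. Each of these is forced by `f` modulo the square of a prime unramified in `K`,
through the action of inertia:

* if `f ≡ X ^ d` and `g ≡ X ^ (d - 1)` modulo `q`, and `q ^ 2` divides `f(0)` but not `g(0)`, then
  every `g ∘ f^m` is an Eisenstein polynomial at `q`, and inertia is transitive on its roots;
* if `f ≡ X ^ (d - 1) (X - d)` and `g ≡ X ^ (d - 2) (X - (d - 1))` modulo `r`, with the same
  condition modulo `r ^ 2`, the argument applies to all but one of the roots in a fibre;
* if `g ∘ f^m ≡ X ^ 2 Ψ` modulo `p` with `Ψ` separable and `Ψ(0) ≠ 0`, and the constant term of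
  `g ∘ f^m` has `p`-adic valuation one, then inertia is generated by a transposition.

For `m > 0` the last condition is obtained from complex dynamics. When `t` is a parameter for which
the critical point `0` of `F + t` is periodic of exact period `m`, the other critical points escape,
so that over `ℂ` the polynomial `g ∘ (F + t)^m` has a double root at `0` and no other multiple root.
Reducing the algebraic integer `t` modulo a large prime `p` gives an integer parameter with the
required behaviour modulo `p`. Finally, the congruences for the different primes are combined by the
Chinese remainder theorem, and a residue class of coefficient vectors is Zariski dense.
-/

open Polynomial NumberField

section Wreath

open Equiv

variable {e : ℕ} {G : Type} [Group G] {T : Type}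

/-- The imprimitive action of a wreath product on `Fin e × T` built from an action of the base
group on `T`. The element `x` is `(left, 1) * (1, right)`, so the coordinates are permuted first
and the base group then acts at the image coordinate. -/
def wreathPermHom (ρ : G →* Perm T) : SymWreath e G →* Perm (Fin e × T) :=
  MonoidHom.toHomPerm
    { toFun := fun x p => (x.right p.1, ρ (x.left (x.right p.1)) p.2)
      map_one' := by
        funext p
        simp only [SemidirectProduct.one_left, SemidirectProduct.one_right, Pi.one_apply, map_one,
          Perm.coe_one, id_eq]
        rfl
      map_mul' := fun x y => by
        funext p
        refine Prod.ext rfl ?_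
        change ρ ((x * y).left ((x * y).right p.1)) p.2 =
          ρ (x.left (x.right (y.right p.1))) (ρ (y.left (y.right p.1)) p.2)
        have h : (mulAutArrow x.right y.left : Fin e → G) (x.right (y.right p.1)) =
            y.left (y.right p.1) :=
          congrArg y.left (x.right.symm_apply_apply _)
        rw [← Perm.mul_apply, ← map_mul, SemidirectProduct.mul_left, SemidirectProduct.mul_right,
          Pi.mul_apply, Perm.mul_apply, h] }

@[simp]
theorem wreathPermHom_apply (ρ : G →* Perm T) (x : SymWreath e G) (p : Fin e × T) :
    wreathPermHom ρ x p = (x.right p.1, ρ (x.left (x.right p.1)) p.2) := rfl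

theorem wreathPermHom_injective [Nonempty T] {ρ : G →* Perm T} (hρ : Function.Injective ρ) :
    Function.Injective (wreathPermHom (e := e) ρ) := by
  obtain ⟨t⟩ := ‹Nonempty T›
  intro x y h
  have hp : ∀ p, wreathPermHom ρ x p = wreathPermHom ρ y p := fun p => by rw [h]
  simp only [wreathPermHom_apply, Prod.mk.injEq] at hp
  have hright : x.right = y.right := Equiv.ext fun i => (hp (i, t)).1
  refine SemidirectProduct.ext (funext fun i => hρ (Equiv.ext fun w => ?_)) hright
  have hw := (hp (x.right.symm i, w)).2
  rw [← hright] at hw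
  simpa using hw

theorem mem_range_wreathPermHom {ρ : G →* Perm T} {a : Perm (Fin e × T)} :
    a ∈ (wreathPermHom (e := e) ρ).range ↔
      ∃ (σ : Perm (Fin e)) (h : Fin e → G), ∀ i w, a (i, w) = (σ i, ρ (h i) w) := by
  constructor
  · rintro ⟨x, rfl⟩
    exact ⟨x.right, fun i => x.left (x.right i), fun i w => rfl⟩
  · rintro ⟨σ, h, ha⟩
    refine ⟨⟨fun i => h (σ.symm i), σ⟩, Equiv.ext fun p => ?_⟩
    simp [ha]

/-- Words of length `n` on `d` letters, the leaves of the `d`-ary rooted tree of height `n`. -/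
def Word (d : ℕ) : ℕ → Type
  | 0 => PUnit
  | n + 1 => Fin d × Word d n

instance Word.finite (d : ℕ) : ∀ n, Finite (Word d n)
  | 0 => inferInstanceAs (Finite PUnit)
  | n + 1 => by
    have := Word.finite d n
    exact inferInstanceAs (Finite (Fin d × Word d n))

theorem Word.nonempty {d : ℕ} (hd : 0 < d) : ∀ n, Nonempty (Word d n)
  | 0 => ⟨PUnit.unit⟩
  | n + 1 => (Word.nonempty hd n).map fun w => (⟨0, hd⟩, w)

/-- Two words of length `n` agree up to their last `k` letters: the corresponding leaves have the
same ancestor `k` levels up (the root, if `n ≤ k`). -/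
def Word.Agree (d : ℕ) : (n k : ℕ) → Word d n → Word d n → Prop
  | 0, _, _, _ => True
  | n + 1, k, w, v => n + 1 ≤ k ∨ (w.1 = v.1 ∧ Word.Agree d n k w.2 v.2)

theorem Word.agree_of_le {d n k : ℕ} (h : n ≤ k) (w v : Word d n) : Word.Agree d n k w v := by
  cases n with
  | zero => trivial
  | succ n => exact Or.inl h

theorem Word.agree_succ {d n k : ℕ} (h : k ≤ n) (w v : Word d (n + 1)) :
    Word.Agree d (n + 1) k w v ↔ w.1 = v.1 ∧ Word.Agree d n k w.2 v.2 :=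
  ⟨fun H => H.resolve_left (by lia), Or.inr⟩

theorem mem_range_wreathPermHom_word {d n : ℕ} {ρ : G →* Perm (Word d n)} (hd : 0 < d)
    (hρ : ∀ a, a ∈ ρ.range ↔ ∀ k w v, Word.Agree d n k (a w) (a v) ↔ Word.Agree d n k w v)
    (a : Perm (Fin e × Word d n)) :
    a ∈ (wreathPermHom (e := e) ρ).range ↔ ∀ k ≤ n, ∀ x y,
      ((a x).1 = (a y).1 ∧ Word.Agree d n k (a x).2 (a y).2) ↔
        (x.1 = y.1 ∧ Word.Agree d n k x.2 y.2) := by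
  rw [mem_range_wreathPermHom]
  constructor
  · rintro ⟨σ, h, ha⟩ k - ⟨i, w⟩ ⟨j, v⟩
    simp only [ha, σ.injective.eq_iff]
    refine and_congr_right ?_
    rintro rfl
    exact (hρ (ρ (h i))).1 ⟨_, rfl⟩ k w v
  · intro H
    obtain ⟨w₀⟩ := Word.nonempty hd n
    have hfst : ∀ x y, (a x).1 = (a y).1 ↔ x.1 = y.1 := fun x y => by
      simpa only [Word.agree_of_le le_rfl, and_true] using H n le_rfl x y
    have hσ : Function.Injective fun i => (a (i, w₀)).1 := fun i j h => (hfst _ _).1 h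
    have hfibre : ∀ i, Function.Injective fun w => (a (i, w)).2 := fun i w v h => by
      have : a (i, w) = a (i, v) := Prod.ext ((hfst _ _).2 rfl) h
      simpa only [EmbeddingLike.apply_eq_iff_eq, Prod.mk.injEq, true_and] using this
    have hG : ∀ i, ∃ h : G, ∀ w, ρ h w = (a (i, w)).2 := fun i => by
      obtain ⟨h, hh⟩ := (hρ (Equiv.ofBijective _ (Finite.injective_iff_bijective.1 (hfibre i)))).2
        (by
          intro k w v
          rcases le_total k n with hk | hk
          · simpa [hfst] using H k hk (i, w) (i, v)
          · simp only [Word.agree_of_le hk])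
      exact ⟨h, fun w => by rw [hh]; rfl⟩
    choose h hh using hG
    refine ⟨Equiv.ofBijective _ (Finite.injective_iff_bijective.1 hσ), h, fun i w => ?_⟩
    exact Prod.ext ((hfst _ _).2 rfl) (hh i w).symm

theorem exists_injective_hom_iteratedSymWreath {d : ℕ} (hd : 0 < d) (n : ℕ) :
    ∃ ρ : iteratedSymWreath d n →* Perm (Word d n), Function.Injective ρ ∧
      ∀ a, a ∈ ρ.range ↔ ∀ k w v, Word.Agree d n k (a w) (a v) ↔ Word.Agree d n k w v := by
  induction n with
  | zero =>
    have hs : Subsingleton (Word d 0) := inferInstanceAs (Subsingleton PUnit)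
    refine ⟨1, fun x y _ => Subsingleton.elim (α := PUnit) x y, fun a => ?_⟩
    exact ⟨fun _ _ _ _ => Iff.rfl, fun _ => ⟨1, Equiv.ext fun _ => hs.elim _ _⟩⟩
  | succ n ih =>
    obtain ⟨ρ, hinj, hρ⟩ := ih
    have := Word.nonempty hd n
    refine ⟨wreathPermHom (e := d) ρ, wreathPermHom_injective hinj, fun a => ?_⟩
    refine (mem_range_wreathPermHom_word hd hρ a).trans ⟨fun H k w v => ?_, fun H k hk x y => ?_⟩
    · rcases le_or_gt k n with hk | hk
      · rw [Word.agree_succ hk, Word.agree_succ hk]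
        exact H k hk w v
      · exact iff_of_true (Word.agree_of_le hk _ _) (Word.agree_of_le hk _ _)
    · exact (Word.agree_succ hk _ _).symm.trans ((H k x y).trans (Word.agree_succ hk _ _))

end Wreath

section Labelling

open Equiv

variable {A : Type*} (φ : A → A) {d e n : ℕ}

theorem exists_word_equiv_of_fibers {B : Set A} (ε : Fin e ≃ B)
    (l : ∀ i, ∃ l : Word d n ≃ φ^[n] ⁻¹' {(ε i : A)},
      ∀ k w v, φ^[k] (l w) = φ^[k] (l v) ↔ Word.Agree d n k w v) :
    ∃ l : Fin e × Word d n ≃ φ^[n] ⁻¹' B, ∀ k ≤ n, ∀ p q,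
      φ^[k] (l p) = φ^[k] (l q) ↔ p.1 = q.1 ∧ Word.Agree d n k p.2 q.2 := by
  choose l hl using l
  have hmem : ∀ i w, φ^[n] (l i w) = ε i := fun i w => (l i w).2
  let L : Fin e × Word d n → φ^[n] ⁻¹' B := fun p =>
    ⟨l p.1 p.2, by rw [Set.mem_preimage, hmem]; exact (ε p.1).2⟩
  have hfst : ∀ k ≤ n, ∀ p q, φ^[k] (L p) = φ^[k] (L q) → p.1 = q.1 := fun k hk p q h => by
    apply ε.injective
    apply Subtype.ext
    have hn : ∀ x, φ^[n - k] (φ^[k] x) = φ^[n] x := fun x => by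
      rw [← Function.iterate_add_apply, Nat.sub_add_cancel hk]
    rw [← hmem p.1 p.2, ← hmem q.1 q.2, ← hn, ← hn]
    exact congrArg φ^[n - k] h
  have hL : ∀ k ≤ n, ∀ p q, φ^[k] (L p) = φ^[k] (L q) ↔
      p.1 = q.1 ∧ Word.Agree d n k p.2 q.2 := by
    rintro k hk ⟨i, w⟩ ⟨j, v⟩
    by_cases hij : i = j
    · subst hij
      simpa only [true_and] using hl i k w v
    · exact iff_of_false (fun h => hij (hfst k hk _ _ h)) fun h => hij h.1
  refine ⟨Equiv.ofBijective L ⟨fun p q h => ?_, fun x => ?_⟩, hL⟩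
  · have hpq := hfst 0 (Nat.zero_le _) p q (congrArg Subtype.val h)
    obtain ⟨i, w⟩ := p
    obtain ⟨j, v⟩ := q
    obtain rfl : i = j := hpq
    have hw : l i w = l i v := Subtype.ext (congrArg (fun x : φ^[n] ⁻¹' B => (x : A)) h)
    rw [(l i).injective hw]
  · have hx : φ^[n] x = ε (ε.symm ⟨_, x.2⟩) := by rw [apply_symm_apply]
    exact ⟨(ε.symm ⟨_, x.2⟩, (l _).symm ⟨x, hx⟩), Subtype.ext (by simp only [L, apply_symm_apply])⟩

theorem exists_word_equiv (n : ℕ) (β : A)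
    (hfib : ∀ m < n, ∀ x, φ^[m] x = β → Nonempty (Fin d ≃ φ ⁻¹' {x})) :
    ∃ l : Word d n ≃ φ^[n] ⁻¹' {β},
      ∀ k w v, φ^[k] (l w) = φ^[k] (l v) ↔ Word.Agree d n k w v := by
  induction n generalizing β with
  | zero =>
    exact ⟨⟨fun _ => ⟨β, rfl⟩, fun _ => PUnit.unit, fun _ => rfl, fun x => Subtype.ext x.2.symm⟩,
      fun k w v => iff_of_true rfl trivial⟩
  | succ n ih =>
    obtain ⟨ε⟩ := hfib 0 (Nat.succ_pos n) β rfl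
    obtain ⟨l, hl⟩ := exists_word_equiv_of_fibers φ ε
      (fun i => ih (ε i) fun m hm x hx => hfib (m + 1) (by lia) x (by
        rw [Function.iterate_succ_apply', hx]; exact (ε i).2))
    refine ⟨l.trans (Equiv.setCongr (by rw [Function.iterate_succ', Set.preimage_comp])),
      fun k w v => ?_⟩
    rcases le_or_gt k n with hk | hk
    · rw [Word.agree_succ hk]
      exact hl k hk w v
    · refine iff_of_true ?_ (Word.agree_of_le hk _ _)
      have hroot : ∀ x : φ^[n + 1] ⁻¹' {β}, φ^[k] x = φ^[k - (n + 1)] β := fun x => by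
        conv_lhs => rw [← Nat.sub_add_cancel hk, Function.iterate_add_apply, show _ = β from x.2]
      rw [hroot, hroot]

end Labelling

section Tower

open Equiv

variable {Γ A : Type*} [Group Γ] [MulAction Γ A]

variable (Γ) in
/-- `Γ` is transitive on `s`: any point of `s` is moved to any other. -/
def IsTransitiveOn (s : Set A) : Prop :=
  ∀ x ∈ s, ∀ y ∈ s, ∃ γ : Γ, γ • x = y

variable (Γ) in
/-- The stabilizer of some point of `s` is transitive on the rest of `s`. If `s` is a block of a
transitive action of `Γ`, this amounts to double transitivity on `s`. -/
def HasTransitiveStabilizerOn (s : Set A) : Prop :=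
  ∃ x ∈ s, IsTransitiveOn (MulAction.stabilizer Γ x) (s \ {x})

variable (Γ) in
/-- Some element of `Γ` acts on `s` as a transposition. -/
def ActsAsSwapOn (s : Set A) : Prop :=
  ∃ γ : Γ, ∃ a ∈ s, ∃ b ∈ s, a ≠ b ∧ γ • a = b ∧ γ • b = a ∧ ∀ x ∈ s, x ≠ a → x ≠ b → γ • x = x

theorem mem_of_fiberwise_of_swap_mem {X Y : Type*} [Finite X] [DecidableEq X] (π : X → Y)
    (H : Subgroup (Perm X)) (hswap : ∀ x y, π x = π y → swap x y ∈ H) (k : Perm X)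
    (hk : ∀ x, π (k x) = π x) : k ∈ H := by
  have := Fintype.ofFinite X
  induction hc : k.support.card using Nat.strong_induction_on generalizing k with
  | _ c ih =>
    by_cases hk1 : k = 1
    · exact hk1 ▸ H.one_mem
    obtain ⟨x, hx⟩ : ∃ x, k x ≠ x := by
      by_contra! h
      exact hk1 (Equiv.ext h)
    have hs : swap x (k x) ∈ H := hswap _ _ (hk x).symm
    have hmul : swap x (k x) * k ∈ H := by
      refine ih _ (hc ▸ Perm.card_support_swap_mul hx) _ (fun y => ?_) rfl
      rw [Perm.mul_apply, swap_apply_def]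
      split_ifs with hyx hy
      · rw [hk x, ← hk y, hyx]
      · rw [← hk y, hy, hk x]
      · exact hk y
    simpa using H.mul_mem (H.inv_mem hs) hmul

section Layer

variable {Y : Type*} {X : SubMulAction Γ A} {π : A → Y}

theorem exists_smul_pair_eq (hπ : ∀ (γ : Γ) x y, π x = π y → π (γ • x) = π (γ • y))
    (htrans : IsTransitiveOn Γ (X : Set A)) {β : Y}
    (hstab : HasTransitiveStabilizerOn Γ {x | x ∈ X ∧ π x = β}) {x y x' y' : A} (hx : x ∈ X)
    (hy : y ∈ X) (hx' : x' ∈ X) (hy' : y' ∈ X) (h : π x = π y) (h' : π x' = π y') (hne : x ≠ y)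
    (hne' : x' ≠ y') : ∃ γ : Γ, γ • x = x' ∧ γ • y = y' := by
  obtain ⟨x₀, ⟨hx₀, rfl⟩, H⟩ := hstab
  obtain ⟨s, hs⟩ := htrans x hx x₀ hx₀
  obtain ⟨t, ht⟩ := htrans x' hx' x₀ hx₀
  obtain ⟨⟨γ, hγ⟩, hγ'⟩ := H (s • y)
    ⟨⟨X.smul_mem s hy, by rw [← hπ s x y h, hs]⟩,
      fun e => hne (smul_left_cancel s (hs.trans (Set.mem_singleton_iff.1 e).symm))⟩
    (t • y') ⟨⟨X.smul_mem t hy', by rw [← hπ t x' y' h', ht]⟩,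
      fun e => hne' (smul_left_cancel t (ht.trans (Set.mem_singleton_iff.1 e).symm))⟩
  rw [MulAction.mem_stabilizer_iff] at hγ
  rw [Subgroup.mk_smul] at hγ'
  refine ⟨t⁻¹ * γ * s, ?_, ?_⟩
  · rw [mul_smul, mul_smul, hs, hγ, ← ht, inv_smul_smul]
  · rw [mul_smul, mul_smul, hγ', inv_smul_smul]

theorem swap_mem_range_toPermHom [DecidableEq X]
    (hπ : ∀ (γ : Γ) x y, π x = π y → π (γ • x) = π (γ • y))
    (hfib : ∀ x ∈ X, ∃ y ∈ X, y ≠ x ∧ π y = π x)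
    (hpair : ∀ x ∈ X, ∀ y ∈ X, ∀ x' ∈ X, ∀ y' ∈ X, π x = π y → π x' = π y' → x ≠ y → x' ≠ y' →
      ∃ γ : Γ, γ • x = x' ∧ γ • y = y')
    (hswap : ActsAsSwapOn Γ (X : Set A)) (x y : X) (hxy : π x = π y) :
    swap x y ∈ (MulAction.toPermHom Γ X).range := by
  obtain ⟨τ, a, ha, b, hb, hab, hτa, hτb, hτ⟩ := hswap
  have hsiblings : π a = π b := by
    by_contra hne
    obtain ⟨c, hcX, hca, hc⟩ := hfib a ha
    have hcb : c ≠ b := fun h => hne (hc.symm.trans (congrArg π h))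
    apply hne
    rw [← hc, ← hτ c hcX hca hcb, ← hτa]
    exact (hπ τ c a hc)
  by_cases hne : x = y
  · rw [hne, swap_self]
    exact one_mem _
  obtain ⟨γ, hγx, hγy⟩ := hpair a ha b hb x x.2 y y.2 hsiblings hxy hab (mt Subtype.ext hne)
  refine ⟨γ * τ * γ⁻¹, Equiv.ext fun z => Subtype.ext ?_⟩
  rw [MulAction.toPermHom_apply, MulAction.toPerm_apply, SubMulAction.val_smul, mul_smul, mul_smul,
    swap_apply_def]
  split_ifs with hzx hzy
  · rw [hzx, ← hγx, inv_smul_smul, hτa, hγy]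
  · rw [hzy, ← hγy, inv_smul_smul, hτb, hγx]
  · rw [hτ _ (X.smul_mem _ z.2), smul_inv_smul]
    · rw [Ne, inv_smul_eq_iff, hγx]
      exact mt Subtype.ext hzx
    · rw [Ne, inv_smul_eq_iff, hγy]
      exact mt Subtype.ext hzy

/-- Doubly transitive groups containing a transposition are symmetric groups; applied
simultaneously to all fibres of one layer of a tower, the same argument realizes any permutation
that lies over the action of an element of `Γ`. -/
theorem exists_smul_eq_of_actsAsSwapOn [Finite X]
    (hπ : ∀ (γ : Γ) x y, π x = π y → π (γ • x) = π (γ • y))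
    (hfib : ∀ x ∈ X, ∃ y ∈ X, y ≠ x ∧ π y = π x) (htrans : IsTransitiveOn Γ (X : Set A)) {β : Y}
    (hstab : HasTransitiveStabilizerOn Γ {x | x ∈ X ∧ π x = β})
    (hswap : ActsAsSwapOn Γ (X : Set A)) (a : Perm X) (γ₀ : Γ)
    (ha : ∀ x : X, π (a x) = π (γ₀ • (x : A))) : ∃ γ : Γ, ∀ x, γ • x = a x := by
  classical
  obtain ⟨γ, hγ⟩ := mem_of_fiberwise_of_swap_mem (fun x : X => π x) _
    (swap_mem_range_toPermHom hπ hfib (fun x hx y hy x' hx' y' hy' =>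
      exists_smul_pair_eq hπ htrans hstab hx hy hx' hy') hswap)
    ((MulAction.toPermHom Γ X γ₀)⁻¹ * a) (fun x => by
      rw [Perm.mul_apply, ← map_inv, MulAction.toPermHom_apply, MulAction.toPerm_apply,
        SubMulAction.val_smul, hπ _ _ _ (ha x), inv_smul_smul])
  refine ⟨γ₀ * γ, fun x => ?_⟩
  have hγx := congrArg (fun k : Perm X => k x) hγ
  simp only [MulAction.toPermHom_apply, MulAction.toPerm_apply, Perm.mul_apply] at hγx
  rw [mul_smul, hγx]
  exact (MulAction.toPerm γ₀ : Perm X).apply_symm_apply (a x)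

end Layer

theorem exists_perm_comp_eq {X Y : Type*} {π : X → Y} (hπ : Function.Surjective π) (a : Perm X)
    (ha : ∀ x y, π (a x) = π (a y) ↔ π x = π y) : ∃ b : Perm Y, ∀ x, b (π x) = π (a x) := by
  obtain ⟨s, hs⟩ := hπ.hasRightInverse
  have hb : ∀ x, π (a (s (π x))) = π (a x) := fun x => (ha _ _).2 (hs _)
  refine ⟨Equiv.ofBijective (fun y => π (a (s y))) ⟨fun y z h => ?_, fun y => ?_⟩, hb⟩
  · rw [← hs y, ← hs z]
    exact (ha _ _).1 h
  · obtain ⟨x, rfl⟩ := hπ y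
    exact ⟨π (a.symm x), (hb _).trans (congrArg π (a.apply_symm_apply x))⟩

variable (Γ) in
/-- The action of `Γ` on the tower of preimages of `R` under iterates of `φ`, up to height `n` and
with `d` points in each fibre, has all the properties that together force it to realize every
permutation of the tower. -/
structure IsFullTower (φ : A → A) (R : Set A) (d n : ℕ) : Prop where
  map_smul (γ : Γ) (x : A) : φ (γ • x) = γ • φ x
  smul_mem (γ : Γ) : ∀ x ∈ R, γ • x ∈ R
  nonempty_equiv : ∀ m < n, ∀ x, φ^[m] x ∈ R → Nonempty (Fin d ≃ φ ⁻¹' {x})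
  isTransitiveOn : ∀ m ≤ n, IsTransitiveOn Γ (φ^[m] ⁻¹' R)
  base_stabilizer : HasTransitiveStabilizerOn Γ R
  fibre_stabilizer : ∀ m < n, ∃ x, φ^[m] x ∈ R ∧ HasTransitiveStabilizerOn Γ (φ ⁻¹' {x})
  actsAsSwapOn : ∀ m ≤ n, (φ^[m] ⁻¹' R).Nontrivial → ActsAsSwapOn Γ (φ^[m] ⁻¹' R)

namespace IsFullTower

variable {φ : A → A} {R : Set A} {d e n : ℕ}

theorem iterate_smul (h : IsFullTower Γ φ R d n) (k : ℕ) (γ : Γ) (x : A) :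
    φ^[k] (γ • x) = γ • φ^[k] x :=
  (Function.Semiconj.iterate_right (f := (γ • ·)) (fun y => (h.map_smul γ y).symm) k x).symm

/-- The `m`-th level of a tower, with the action of `Γ`. -/
def level (h : IsFullTower Γ φ R d n) (m : ℕ) : SubMulAction Γ A where
  carrier := φ^[m] ⁻¹' R
  smul_mem' γ x hx := by
    rw [Set.mem_preimage, h.iterate_smul]
    exact h.smul_mem γ _ hx

theorem exists_label (h : IsFullTower Γ φ R d n) (ε : Fin e ≃ R) {m : ℕ} (hm : m ≤ n) :
    ∃ l : Fin e × Word d m ≃ h.level m, ∀ k ≤ m, ∀ p q,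
      φ^[k] (l p) = φ^[k] (l q) ↔ p.1 = q.1 ∧ Word.Agree d m k p.2 q.2 :=
  exists_word_equiv_of_fibers φ ε fun i => exists_word_equiv φ m (ε i) fun j hj x hx =>
    h.nonempty_equiv j (hj.trans_le hm) x (by rw [hx]; exact (ε i).2)

theorem finite_level [Finite R] (h : IsFullTower Γ φ R d n) {m : ℕ} (hm : m ≤ n) :
    Finite (h.level m) := by
  obtain ⟨e, ⟨ε⟩⟩ := Finite.exists_equiv_fin R
  obtain ⟨l, -⟩ := h.exists_label ε.symm hm
  exact Finite.of_equiv _ l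

theorem exists_smul_eq_zero_level [Finite R] (h : IsFullTower Γ φ R d n)
    (a : Perm (h.level 0)) : ∃ γ : Γ, ∀ x, γ • x = a x := by
  rcases R.subsingleton_or_nontrivial with hR | hR
  · exact ⟨1, fun x => Subtype.ext (hR (h.smul_mem 1 _ x.2) (a x).2)⟩
  have := h.finite_level (Nat.zero_le n)
  obtain ⟨x₀, hx₀, hstab⟩ := h.base_stabilizer
  refine exists_smul_eq_of_actsAsSwapOn (π := fun _ => ()) (fun _ _ _ _ => rfl) (fun x _ => ?_)
    (h.isTransitiveOn 0 (Nat.zero_le n)) (β := ()) ?_ (h.actsAsSwapOn 0 (Nat.zero_le n) hR) a 1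
    (fun _ => rfl)
  · obtain ⟨y, hy, hyx⟩ := hR.exists_ne x
    exact ⟨y, hy, hyx, rfl⟩
  · exact ⟨x₀, ⟨hx₀, rfl⟩, fun y hy z hz => hstab y ⟨hy.1.1, hy.2⟩ z ⟨hz.1.1, hz.2⟩⟩

theorem exists_smul_eq_succ_level [Finite R] (h : IsFullTower Γ φ R d n) (hd : 2 ≤ d) {m : ℕ}
    (hm : m < n) (a : Perm (h.level (m + 1))) (γ₀ : Γ)
    (ha : ∀ x : h.level (m + 1), φ (a x) = γ₀ • φ x) : ∃ γ : Γ, ∀ x, γ • x = a x := by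
  have := h.finite_level (m := m + 1) hm
  have : Nontrivial (Fin d) := Fin.nontrivial_iff_two_le.2 hd
  have hsibling : ∀ x ∈ h.level (m + 1), ∃ y ∈ h.level (m + 1), y ≠ x ∧ φ y = φ x := by
    intro x hx
    obtain ⟨ζ⟩ := h.nonempty_equiv m hm (φ x) hx
    have : Nontrivial (φ ⁻¹' {φ x}) := ζ.symm.nontrivial
    obtain ⟨⟨y, hy : φ y = φ x⟩, hyx⟩ := exists_ne (⟨x, rfl⟩ : φ ⁻¹' {φ x})
    refine ⟨y, ?_, fun e => hyx (Subtype.ext e), hy⟩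
    change φ^[m] (φ y) ∈ R
    rwa [hy]
  obtain ⟨β, hβ, hstab⟩ := h.fibre_stabilizer m hm
  have hfibre : φ ⁻¹' {β} = {x | x ∈ h.level (m + 1) ∧ φ x = β} := by
    ext x
    refine ⟨fun hx => ⟨?_, hx⟩, fun hx => hx.2⟩
    change φ^[m] (φ x) ∈ R
    rwa [show φ x = β from hx]
  have hnontrivial : (φ^[m + 1] ⁻¹' R).Nontrivial := by
    obtain ⟨x, hx, -⟩ := hfibre ▸ hstab
    obtain ⟨y, hy, hyx, -⟩ := hsibling x hx.1
    exact ⟨y, hy, x, hx.1, hyx⟩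
  refine exists_smul_eq_of_actsAsSwapOn (fun γ x y e => ?_) hsibling
    (h.isTransitiveOn (m + 1) hm) (hfibre ▸ hstab) (h.actsAsSwapOn (m + 1) hm hnontrivial) a γ₀
    (fun x => by rw [ha, h.map_smul])
  rw [h.map_smul, h.map_smul, e]

theorem exists_smul_eq [Finite R] (h : IsFullTower Γ φ R d n) (hd : 2 ≤ d) {m : ℕ} (hm : m ≤ n)
    (a : Perm (h.level m))
    (ha : ∀ k ≤ m, ∀ x y, φ^[k] (a x : A) = φ^[k] (a y : A) ↔ φ^[k] (x : A) = φ^[k] (y : A)) :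
    ∃ γ : Γ, ∀ x, γ • x = a x := by
  induction m with
  | zero => exact h.exists_smul_eq_zero_level a
  | succ m ih =>
    let π : h.level (m + 1) → h.level m := fun x => ⟨φ x, x.2⟩
    have hπ : Function.Surjective π := fun x => by
      obtain ⟨ζ⟩ := h.nonempty_equiv m hm x x.2
      obtain ⟨y, hy : φ y = x⟩ := ζ ⟨0, by lia⟩
      refine ⟨⟨y, ?_⟩, Subtype.ext hy⟩
      change φ^[m] (φ y) ∈ R
      rw [hy]
      exact x.2
    obtain ⟨b, hb⟩ := exists_perm_comp_eq hπ a fun x y => by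
      rw [Subtype.ext_iff, Subtype.ext_iff]
      exact ha 1 (by lia) x y
    obtain ⟨γ₀, hγ₀⟩ := ih (by lia) b (by
      intro k hk x y
      obtain ⟨x, rfl⟩ := hπ x
      obtain ⟨y, rfl⟩ := hπ y
      rw [hb, hb]
      exact ha (k + 1) (by lia) x y)
    refine h.exists_smul_eq_succ_level hd hm a γ₀ fun x => ?_
    exact (congrArg Subtype.val ((hγ₀ (π x)).trans (hb x))).symm

theorem exists_smul_eq_iff_forall_agree [Finite R] (h : IsFullTower Γ φ R d n) (hd : 2 ≤ d)
    {l : Fin e × Word d n ≃ h.level n}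
    (hl : ∀ k ≤ n, ∀ p q, φ^[k] (l p) = φ^[k] (l q) ↔ p.1 = q.1 ∧ Word.Agree d n k p.2 q.2)
    (a : Perm (Fin e × Word d n)) :
    (∃ γ : Γ, ∀ p, l (a p) = γ • l p) ↔ ∀ k ≤ n, ∀ p q,
      ((a p).1 = (a q).1 ∧ Word.Agree d n k (a p).2 (a q).2) ↔
        (p.1 = q.1 ∧ Word.Agree d n k p.2 q.2) := by
  constructor
  · rintro ⟨γ, hγ⟩ k hk p q
    rw [← hl k hk, ← hl k hk, hγ, hγ, SubMulAction.val_smul, SubMulAction.val_smul,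
      h.iterate_smul, h.iterate_smul, smul_left_cancel_iff]
  · intro ha
    obtain ⟨γ, hγ⟩ := h.exists_smul_eq hd le_rfl (l.permCongr a) fun k hk x y => by
      have hxy := hl k hk (l.symm x) (l.symm y)
      rw [l.apply_symm_apply, l.apply_symm_apply] at hxy
      rw [permCongr_apply, permCongr_apply, hl k hk, hxy]
      exact ha k hk _ _
    refine ⟨γ, fun p => ?_⟩
    rw [hγ, permCongr_apply, l.symm_apply_apply]

/-- Both groups are realized as the group of the permutations of the top level, labelled by
words, that respect the tower. -/
theorem nonempty_mulEquiv_symWreath (h : IsFullTower Γ φ R d n) (hd : 2 ≤ d) (ε : Fin e ≃ R)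
    (hfaith : ∀ γ : Γ, (∀ x, φ^[n] x ∈ R → γ • x = x) → γ = 1) :
    Nonempty (Γ ≃* SymWreath e (iteratedSymWreath d n)) := by
  have := Finite.of_equiv _ ε
  obtain ⟨l, hl⟩ := h.exists_label ε le_rfl
  obtain ⟨ρ, hρinj, hρ⟩ := exists_injective_hom_iteratedSymWreath (d := d) (by lia) n
  have := Word.nonempty (d := d) (by lia) n
  let T : Γ →* Perm (Fin e × Word d n) :=
    l.symm.permCongrHom.toMonoidHom.comp (MulAction.toPermHom Γ (h.level n))
  have hT : ∀ γ p, l (T γ p) = γ • l p := fun γ p => l.apply_symm_apply _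
  have hTinj : Function.Injective T := by
    refine (injective_iff_map_eq_one T).2 fun γ hγ => hfaith γ fun x hx => ?_
    have hfix := hT γ (l.symm ⟨x, hx⟩)
    rw [hγ, Perm.one_apply, l.apply_symm_apply] at hfix
    exact (congrArg Subtype.val hfix).symm
  have hrange : T.range = (wreathPermHom (e := e) ρ).range := by
    ext a
    rw [mem_range_wreathPermHom_word (by lia) hρ a, ← h.exists_smul_eq_iff_forall_agree hd hl]
    constructor
    · rintro ⟨γ, rfl⟩
      exact ⟨γ, hT γ⟩
    · rintro ⟨γ, hγ⟩
      exact ⟨γ, Equiv.ext fun p => l.injective ((hT γ p).trans (hγ p).symm)⟩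
  exact ⟨(MonoidHom.ofInjective hTinj).trans ((MulEquiv.subgroupCongr hrange).trans
    (MonoidHom.ofInjective (wreathPermHom_injective hρinj)).symm)⟩

end IsFullTower

end Tower

section Reduction

section Domain

variable {A ι : Type*} [CommRing A] [IsDomain A]

theorem exists_eq_of_prod_X_sub_C_eq_mul [DecidableEq ι] {S : Finset ι} {q : ι → A} {Φ : A[X]}
    {c : A} (h : ∏ i ∈ S, (X - C (q i)) = (X - C c) * Φ) :
    ∃ a ∈ S, q a = c ∧ ∏ i ∈ S.erase a, (X - C (q i)) = Φ := by
  have hroot : ∏ i ∈ S, (c - q i) = 0 := by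
    simpa [eval_prod] using congrArg (eval c) h
  obtain ⟨a, ha, hqa⟩ := Finset.prod_eq_zero_iff.1 hroot
  have hqa : q a = c := (sub_eq_zero.1 hqa).symm
  refine ⟨a, ha, hqa, mul_left_cancel₀ (X_sub_C_ne_zero c) ?_⟩
  rw [← h, ← Finset.mul_prod_erase S _ ha, hqa]

theorem eq_zero_of_prod_X_sub_C_eq_X_pow {S : Finset ι} {q : ι → A} {k : ℕ}
    (h : ∏ i ∈ S, (X - C (q i)) = X ^ k) {a : ι} (ha : a ∈ S) : q a = 0 := by
  have hroot : ∏ i ∈ S, (q a - q i) = q a ^ k := by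
    simpa [eval_prod] using congrArg (eval (q a)) h
  exact eq_zero_of_pow_eq_zero (hroot.symm.trans (Finset.prod_eq_zero ha (sub_self _)))

theorem exists_of_prod_X_sub_C_eq_X_pow_mul {S : Finset ι} {q : ι → A} {k : ℕ} {c : A}
    (h : ∏ i ∈ S, (X - C (q i)) = X ^ k * (X - C c)) :
    ∃ a ∈ S, q a = c ∧ ∀ b ∈ S, b ≠ a → q b = 0 := by
  classical
  obtain ⟨a, ha, hqa, h⟩ := exists_eq_of_prod_X_sub_C_eq_mul (h.trans (mul_comm _ _))
  exact ⟨a, ha, hqa, fun b hb hba =>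
    eq_zero_of_prod_X_sub_C_eq_X_pow h (Finset.mem_erase.2 ⟨hba, hb⟩)⟩

theorem exists_pair_of_prod_X_sub_C_eq_X_sq_mul {S : Finset ι} {q : ι → A} {Φ : A[X]}
    (h : ∏ i ∈ S, (X - C (q i)) = X ^ 2 * Φ) (hsep : Φ.Separable) (h0 : Φ.eval 0 ≠ 0) :
    ∃ a ∈ S, ∃ b ∈ S, a ≠ b ∧ q a = 0 ∧ q b = 0 ∧ (∀ c ∈ S, q c = 0 → c = a ∨ c = b) ∧
      ∀ r ∈ S, ∀ s ∈ S, q r ≠ 0 → q r = q s → r = s := by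
  classical
  replace h : ∏ i ∈ S, (X - C (q i)) = (X - C 0) * ((X - C 0) * Φ) := by
    rw [h, C_0, sub_zero, pow_two, mul_assoc]
  obtain ⟨a, ha, hqa, h⟩ := exists_eq_of_prod_X_sub_C_eq_mul h
  obtain ⟨b, hb, hqb, h⟩ := exists_eq_of_prod_X_sub_C_eq_mul h
  obtain ⟨hba, hbS⟩ := Finset.mem_erase.1 hb
  have mem_rest : ∀ t ∈ S, q t ≠ 0 → t ∈ (S.erase a).erase b := fun t ht hqt =>
    Finset.mem_erase.2 ⟨ne_of_apply_ne q (by rwa [hqb]),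
      Finset.mem_erase.2 ⟨ne_of_apply_ne q (by rwa [hqa]), ht⟩⟩
  refine ⟨a, ha, b, hbS, hba.symm, hqa, hqb, fun c hc hqc => ?_, fun r hr s hs hqr hrs => ?_⟩
  · by_contra! hne
    apply h0
    rw [← h, eval_prod]
    exact Finset.prod_eq_zero (i := c) (by simp [hc, hne]) (by simp [hqc])
  · rw [← h] at hsep
    exact hsep.inj_of_prod_X_sub_C (mem_rest r hr hqr) (mem_rest s hs (hrs ▸ hqr)) hrs

end Domain

variable {A : Type*} [CommRing A] {h : ℤ[X]} {S : Finset A}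

theorem mem_iff_aeval_eq_of_map_sub_C_eq_prod [IsDomain A] {β : A}
    (hS : h.map (Int.castRingHom A) - C β = ∏ r ∈ S, (X - C r)) (z : A) :
    z ∈ S ↔ aeval z h = β := by
  rw [← sub_eq_zero (a := aeval z h), aeval_def, ← eval_map, algebraMap_int_eq, ← eval_C (a := β),
    ← eval_sub, hS, eval_prod, Finset.prod_eq_zero_iff]
  simp [sub_eq_zero]

theorem mem_iff_aeval_eq_zero_of_map_eq_prod [IsDomain A]
    (hS : h.map (Int.castRingHom A) = ∏ r ∈ S, (X - C r)) (z : A) : z ∈ S ↔ aeval z h = 0 :=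
  mem_iff_aeval_eq_of_map_sub_C_eq_prod (by rw [C_0, sub_zero, hS]) z

theorem coeff_zero_eq_prod_neg (hS : h.map (Int.castRingHom A) = ∏ r ∈ S, (X - C r)) :
    ((h.coeff 0 : ℤ) : A) = ∏ r ∈ S, -r := by
  simpa [coeff_zero_prod] using congrArg (fun q => q.coeff 0) hS

theorem smul_mem_of_map_eq_prod {G : Type*} [IsDomain A] [Group G] [MulSemiringAction G A]
    (hS : h.map (Int.castRingHom A) = ∏ r ∈ S, (X - C r)) (σ : G) {z : A} (hz : z ∈ S) :
    σ • z ∈ S := by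
  rw [mem_iff_aeval_eq_zero_of_map_eq_prod hS] at hz ⊢
  rw [aeval_smul, hz, smul_zero]

variable {p : ℕ} (P : Ideal A)

theorem intCast_mem_iff_dvd_of_liesOver [P.LiesOver (Ideal.span {(p : ℤ)})] (n : ℤ) :
    (n : A) ∈ P ↔ (p : ℤ) ∣ n := by
  rw [← Ideal.mem_span_singleton, Ideal.mem_of_liesOver P (Ideal.span {(p : ℤ)}),
    algebraMap_int_eq, eq_intCast]

theorem natCast_mem_of_liesOver [P.LiesOver (Ideal.span {(p : ℤ)})] : (p : A) ∈ P := by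
  simpa using (intCast_mem_iff_dvd_of_liesOver (p := p) P p).2 dvd_rfl

/- The factor `∏ y ∈ V, (X - C y)` is all roots of `h` for `β = 0`, and the fibre of `h` over `β`
in general. -/
theorem exists_prod_X_sub_C_mk_eq_map [Fact p.Prime] [P.IsPrime]
    [P.LiesOver (Ideal.span {(p : ℤ)})] :
    ∃ ψ : ZMod p →+* A ⧸ P, ∀ (h : ℤ[X]) (V : Finset A), ∀ β ∈ P,
      h.map (Int.castRingHom A) - C β = ∏ y ∈ V, (X - C y) →
      ∏ y ∈ V, (X - C (Ideal.Quotient.mk P y)) = (h.map (Int.castRingHom (ZMod p))).map ψ := by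
  have : CharP (A ⧸ P) p := (CharP.charP_iff_prime_eq_zero Fact.out).2
    (by simpa using Ideal.Quotient.eq_zero_iff_mem.2 (natCast_mem_of_liesOver P))
  refine ⟨ZMod.castHom dvd_rfl (A ⧸ P), fun h V β hβ hV => ?_⟩
  calc
    _ = (h.map (Int.castRingHom A) - C β).map (Ideal.Quotient.mk P) := by
      simp [hV, Polynomial.map_prod]
    _ = h.map ((Ideal.Quotient.mk P).comp (Int.castRingHom A)) := by
      rw [Polynomial.map_sub, map_C, Ideal.Quotient.eq_zero_iff_mem.2 hβ, C_0, sub_zero, map_map]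
    _ = _ := by
      rw [map_map]
      exact congrArg (h.map ·) (RingHom.ext_int _ _)

theorem mem_of_map_eq_X_pow [Fact p.Prime] [P.IsPrime] [P.LiesOver (Ideal.span {(p : ℤ)})]
    (hS : h.map (Int.castRingHom A) = ∏ r ∈ S, (X - C r)) {k : ℕ}
    (hh : h.map (Int.castRingHom (ZMod p)) = X ^ k) {r : A} (hr : r ∈ S) : r ∈ P := by
  obtain ⟨ψ, hψ⟩ := exists_prod_X_sub_C_mk_eq_map (p := p) P
  have hred := hψ h S 0 P.zero_mem (by rw [C_0, sub_zero, hS])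
  rw [hh, Polynomial.map_pow, map_X] at hred
  exact Ideal.Quotient.eq_zero_iff_mem.1 (eq_zero_of_prod_X_sub_C_eq_X_pow hred hr)

theorem exists_notMem_of_map_eq_X_pow_mul [Fact p.Prime] [P.IsPrime]
    [P.LiesOver (Ideal.span {(p : ℤ)})] {V : Finset A} {β : A} (hβ : β ∈ P)
    (hV : h.map (Int.castRingHom A) - C β = ∏ y ∈ V, (X - C y)) {k : ℕ} {c : ZMod p} (hc : c ≠ 0)
    (hh : h.map (Int.castRingHom (ZMod p)) = X ^ k * (X - C c)) :
    ∃ a ∈ V, a ∉ P ∧ ∀ b ∈ V, b ≠ a → b ∈ P := by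
  obtain ⟨ψ, hψ⟩ := exists_prod_X_sub_C_mk_eq_map (p := p) P
  have hred := hψ h V β hβ hV
  rw [hh, Polynomial.map_mul, Polynomial.map_pow, Polynomial.map_sub, map_X, map_C] at hred
  obtain ⟨a, ha, hac, hb⟩ := exists_of_prod_X_sub_C_eq_X_pow_mul hred
  simp only [Ideal.Quotient.eq_zero_iff_mem] at hb
  refine ⟨a, ha, fun haP => hc ?_, hb⟩
  rwa [Ideal.Quotient.eq_zero_iff_mem.2 haP, eq_comm, map_eq_zero] at hac

theorem exists_pair_of_map_eq_X_sq_mul [Fact p.Prime] [P.IsPrime]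
    [P.LiesOver (Ideal.span {(p : ℤ)})] (hS : h.map (Int.castRingHom A) = ∏ r ∈ S, (X - C r))
    {Ψ : (ZMod p)[X]} (hh : h.map (Int.castRingHom (ZMod p)) = X ^ 2 * Ψ) (hsep : Ψ.Separable)
    (h0 : Ψ.eval 0 ≠ 0) :
    ∃ a ∈ S, ∃ b ∈ S, a ≠ b ∧ a ∈ P ∧ b ∈ P ∧ (∀ c ∈ S, c ∈ P → c = a ∨ c = b) ∧
      ∀ r ∈ S, ∀ s ∈ S, r ∉ P → r - s ∈ P → r = s := by
  obtain ⟨ψ, hψ⟩ := exists_prod_X_sub_C_mk_eq_map (p := p) P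
  have hred := hψ h S 0 P.zero_mem (by rw [C_0, sub_zero, hS])
  rw [hh, Polynomial.map_mul, Polynomial.map_pow, map_X] at hred
  have h0 : (Ψ.map ψ).eval 0 ≠ 0 := by rwa [eval_zero_map, Ne, map_eq_zero]
  simpa only [ne_eq, Ideal.Quotient.eq_zero_iff_mem, Ideal.Quotient.eq] using
    exists_pair_of_prod_X_sub_C_eq_X_sq_mul hred hsep.map h0

end Reduction

section Inertia

variable {p : ℕ}

theorem ne_bot_of_liesOver_prime [Fact p.Prime] {A : Type*} [CommRing A] [CharZero A]
    (P : Ideal A) [P.LiesOver (Ideal.span {(p : ℤ)})] : P ≠ ⊥ := by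
  rintro rfl
  exact (Fact.out : p.Prime).ne_zero (by simpa using natCast_mem_of_liesOver (p := p) (⊥ : Ideal A))

variable {K L : Type*} [Field K] [Field L] [NumberField K] [Algebra K L]

variable (P : Ideal (𝓞 L)) [P.IsPrime]

theorem ramificationIdx_int_eq_of_not_dvd_discr [Fact p.Prime] (hdisc : ¬ (p : ℤ) ∣ discr K)
    [P.LiesOver (Ideal.span {(p : ℤ)})] : P.ramificationIdx ℤ = P.ramificationIdx (𝓞 K) := by
  have : Algebra.IsUnramifiedAt ℤ (P.under (𝓞 K)) :=
    (not_dvd_discr_iff_forall_mem K (𝓞 K) (Nat.prime_iff_prime_int.1 Fact.out)).1 hdisc _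
      inferInstance (by simpa [Ideal.mem_comap] using natCast_mem_of_liesOver (p := p) P)
  rw [Ideal.ramificationIdx_tower (R := ℤ) (P.under (𝓞 K)) P, Ideal.ramificationIdx_eq_one, one_mul]

variable [NumberField L]

/- The ramification index of `P` over `K` is the order of inertia, which is also the ramification
index of `P` over the inertia field; an element of `P` fixed by inertia lies in that field. -/
theorem mem_pow_ramificationIdx_of_forall_inertia_smul_eq [IsGalois K L] (hP : P ≠ ⊥) {x : 𝓞 L}
    (hx : x ∈ P) (hfix : ∀ σ ∈ P.inertia Gal(L/K), σ • x = x) :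
    x ∈ P ^ P.ramificationIdx (𝓞 K) := by
  let H := P.inertia Gal(L/K)
  let E : IntermediateField K L := FixedPoints.intermediateField H
  have : IsGaloisGroup H E L := IsGaloisGroup.subgroup Gal(L/K) K L H
  have : SMulDistribClass H (𝓞 L) L :=
    ⟨fun σ a b => smul_distrib_smul (σ : Gal(L/K)) a b⟩
  have : IsGaloisGroup H (𝓞 E) (𝓞 L) := IsGaloisGroup.of_isFractionRing H (𝓞 E) (𝓞 L) E L
  have : P.IsMaximal := Ring.DimensionLEOne.maximalOfPrime hP inferInstance
  let pE := P.under (𝓞 E)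
  let pK := P.under (𝓞 K)
  have hpE : pE ≠ ⊥ := Ideal.under_ne_bot _ hP
  have hpK : pK ≠ ⊥ := Ideal.under_ne_bot _ hP
  have : pE.IsMaximal := Ideal.IsMaximal.under _ P
  have : pK.IsMaximal := Ideal.IsMaximal.under _ P
  have : Finite (𝓞 E ⧸ pE) := Ring.HasFiniteQuotients.finiteQuotient hpE
  have : Finite (𝓞 K ⧸ pK) := Ring.HasFiniteQuotients.finiteQuotient hpK
  have card_over_K : Nat.card H = P.ramificationIdx (𝓞 K) := by
    rw [Ideal.card_inertia_eq_ramificationIdxIn pK P,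
      Ideal.ramificationIdxIn_eq_ramificationIdx pK P Gal(L/K)]
  have card_over_E : Nat.card (P.inertia H) = P.ramificationIdx (𝓞 E) := by
    rw [Ideal.card_inertia_eq_ramificationIdxIn pE P,
      Ideal.ramificationIdxIn_eq_ramificationIdx pE P H]
  have inertia_eq_top : P.inertia H = ⊤ := eq_top_iff.2 fun σ _ => Ideal.coe_mem_inertia.1 σ.2
  have ramificationIdx_eq : P.ramificationIdx (𝓞 E) = P.ramificationIdx (𝓞 K) := by
    rw [← card_over_K, ← card_over_E, inertia_eq_top, Nat.card_congr Subgroup.topEquiv.toEquiv]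
  obtain ⟨y, rfl⟩ := Algebra.IsInvariant.isInvariant (A := 𝓞 E) (B := 𝓞 L) (G := H) x
    fun σ => hfix σ σ.2
  have map_le := Ideal.le_pow_ramificationIdx' (p := pE) (P := P)
  rw [Ideal.ramificationIdx'_eq_ramificationIdx _ _ hpE, ramificationIdx_eq] at map_le
  exact map_le (Ideal.mem_map_of_mem _ hx)

theorem natCast_notMem_pow_ramificationIdx_succ [Fact p.Prime] (hdisc : ¬ (p : ℤ) ∣ discr K)
    [P.LiesOver (Ideal.span {(p : ℤ)})] : (p : 𝓞 L) ∉ P ^ (P.ramificationIdx (𝓞 K) + 1) := by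
  have map_ne_bot : (Ideal.span {(p : ℤ)}).map (algebraMap ℤ (𝓞 L)) ≠ ⊥ :=
    Ideal.map_ne_bot_of_ne_bot (by simpa using (Fact.out : p.Prime).ne_zero)
  have hfin : FiniteMultiplicity P ((Ideal.span {(p : ℤ)}).map (algebraMap ℤ (𝓞 L))) :=
    .of_not_isUnit (by simpa [Ideal.isUnit_iff] using Ideal.IsPrime.ne_top inferInstance)
      map_ne_bot
  rw [← ramificationIdx_int_eq_of_not_dvd_discr P hdisc,
    Ideal.IsDedekindDomain.ramificationIdx_eq_multiplicity (Ideal.span {(p : ℤ)}) P map_ne_bot]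
  simpa [Ideal.dvd_iff_le, Ideal.map_span, Ideal.span_le] using
    hfin.not_pow_dvd_of_multiplicity_lt (Nat.lt_succ_self _)

theorem prod_mem_pow_ramificationIdx [IsGalois K L] (hP : P ≠ ⊥) {U : Finset (𝓞 L)}
    (hU : ∀ σ ∈ P.inertia Gal(L/K), ∀ z ∈ U, σ • z ∈ U) {x : 𝓞 L} (hx : x ∈ U) (hxP : x ∈ P) :
    ∏ z ∈ U, z ∈ P ^ P.ramificationIdx (𝓞 K) := by
  refine mem_pow_ramificationIdx_of_forall_inertia_smul_eq P hP
    (Ideal.mem_of_dvd _ (Finset.dvd_prod_of_mem _ hx) hxP) fun σ hσ => ?_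
  rw [Finset.smul_prod']
  exact Finset.prod_bij (fun z _ => σ • z) (fun z hz => hU σ hσ z hz)
    (fun a _ b _ hab => smul_left_cancel σ hab)
    (fun z hz => ⟨σ⁻¹ • z, hU _ (inv_mem hσ) z hz, by simp⟩) fun _ _ => rfl

/- Otherwise the roots split into two inertia-stable parts, each of which meets `P`. -/
theorem prod_mem_pow_ramificationIdx_succ [IsGalois K L] (hP : P ≠ ⊥) {S : Finset (𝓞 L)}
    (hS : ∀ (σ : Gal(L/K)), ∀ z ∈ S, σ • z ∈ S) {x y : 𝓞 L} (hx : x ∈ S) (hxP : x ∈ P)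
    (hy : y ∈ S) (hyP : y ∈ P) (hxy : ∀ σ ∈ P.inertia Gal(L/K), σ • x ≠ y) :
    ∏ z ∈ S, z ∈ P ^ (P.ramificationIdx (𝓞 K) + 1) := by
  classical
  let conj (z : 𝓞 L) : Prop := ∃ σ ∈ P.inertia Gal(L/K), σ • x = z
  have conj_smul : ∀ σ ∈ P.inertia Gal(L/K), ∀ z, conj (σ • z) ↔ conj z := fun σ hσ z =>
    ⟨fun ⟨τ, hτ, h⟩ => ⟨σ⁻¹ * τ, mul_mem (inv_mem hσ) hτ, by rw [mul_smul, h, inv_smul_smul]⟩,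
      fun ⟨τ, hτ, h⟩ => ⟨σ * τ, mul_mem hσ hτ, by rw [mul_smul, h]⟩⟩
  have mem_orbit : ∏ z ∈ S with conj z, z ∈ P ^ P.ramificationIdx (𝓞 K) :=
    prod_mem_pow_ramificationIdx P hP
      (fun σ hσ z hz => by
        rw [Finset.mem_filter] at hz ⊢
        exact ⟨hS σ z hz.1, (conj_smul σ hσ z).2 hz.2⟩)
      (Finset.mem_filter.2 ⟨hx, 1, one_mem _, one_smul _ _⟩) hxP
  have mem_rest : ∏ z ∈ S with ¬ conj z, z ∈ P ^ P.ramificationIdx (𝓞 K) :=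
    prod_mem_pow_ramificationIdx P hP
      (fun σ hσ z hz => by
        rw [Finset.mem_filter] at hz ⊢
        exact ⟨hS σ z hz.1, mt (conj_smul σ hσ z).1 hz.2⟩)
      (Finset.mem_filter.2 ⟨hy, fun ⟨σ, hσ, h⟩ => hxy σ hσ h⟩) hyP
  have := Ideal.mul_mem_mul mem_orbit mem_rest
  rw [Finset.prod_filter_mul_prod_filter_not, ← pow_add] at this
  exact Ideal.pow_le_pow_right (by have := Ideal.ramificationIdx_pos P (𝓞 K); lia) this

theorem exists_mem_inertia_smul_eq [IsGalois K L] [Fact p.Prime] (hdisc : ¬ (p : ℤ) ∣ discr K)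
    [P.LiesOver (Ideal.span {(p : ℤ)})] {h : ℤ[X]} {S : Finset (𝓞 L)}
    (hS : h.map (Int.castRingHom (𝓞 L)) = ∏ r ∈ S, (X - C r)) (hndvd : ¬ (p : ℤ) ^ 2 ∣ h.coeff 0)
    {x y : 𝓞 L} (hx : x ∈ S) (hxP : x ∈ P) (hy : y ∈ S) (hyP : y ∈ P) :
    ∃ σ ∈ P.inertia Gal(L/K), σ • x = y := by
  by_contra! hxy
  have coeff_mem : ((h.coeff 0 : ℤ) : 𝓞 L) ∈ P ^ (P.ramificationIdx (𝓞 K) + 1) := by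
    rw [coeff_zero_eq_prod_neg hS, Finset.prod_neg]
    exact Ideal.mul_mem_left _ _ <| prod_mem_pow_ramificationIdx_succ P
      (ne_bot_of_liesOver_prime (p := p) P)
      (fun σ _ hz => smul_mem_of_map_eq_prod hS σ hz) hx hxP hy hyP hxy
  obtain ⟨u, hu⟩ : (p : ℤ) ∣ h.coeff 0 :=
    (intCast_mem_iff_dvd_of_liesOver P _).1 (Ideal.pow_le_self (Nat.succ_ne_zero _) coeff_mem)
  rw [hu, Int.cast_mul, Int.cast_natCast, mul_comm] at coeff_mem
  rcases Ideal.IsPrime.mul_mem_pow P coeff_mem with u_mem | p_mem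
  · exact hndvd (hu ▸ pow_two (p : ℤ) ▸
      mul_dvd_mul_left _ ((intCast_mem_iff_dvd_of_liesOver P u).1 u_mem))
  · exact natCast_notMem_pow_ramificationIdx_succ P hdisc p_mem

variable (L) in
theorem exists_isPrime_liesOver (p : ℕ) [hp : Fact p.Prime] :
    ∃ P : Ideal (𝓞 L), P.IsPrime ∧ P.LiesOver (Ideal.span {(p : ℤ)}) := by
  have : (Ideal.span {(p : ℤ)}).IsMaximal :=
    PrincipalIdealRing.isMaximal_of_irreducible (Nat.prime_iff_prime_int.1 hp.out).irreducible
  obtain ⟨P, hP, hover⟩ := Ideal.exists_maximal_ideal_liesOver_of_isIntegral (S := 𝓞 L)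
    (Ideal.span {(p : ℤ)})
  exact ⟨P, hP.isPrime, hover⟩

theorem isTransitiveOn_of_map_eq_X_pow [IsGalois K L] [Fact p.Prime] (hdisc : ¬ (p : ℤ) ∣ discr K)
    {h : ℤ[X]} {S : Finset (𝓞 L)} (hS : h.map (Int.castRingHom (𝓞 L)) = ∏ r ∈ S, (X - C r))
    {k : ℕ} (hh : h.map (Int.castRingHom (ZMod p)) = X ^ k) (hndvd : ¬ (p : ℤ) ^ 2 ∣ h.coeff 0) :
    IsTransitiveOn Gal(L/K) (S : Set (𝓞 L)) := by
  intro x hx y hy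
  obtain ⟨P, _, _⟩ := exists_isPrime_liesOver L p
  obtain ⟨σ, -, hσ⟩ := exists_mem_inertia_smul_eq (K := K) P hdisc hS hndvd hx
    (mem_of_map_eq_X_pow P hS hh hx) hy (mem_of_map_eq_X_pow P hS hh hy)
  exact ⟨σ, hσ⟩

/- Inertia at `P` fixes the only element of `V` outside `P`. -/
theorem hasTransitiveStabilizerOn_of_map_eq_X_pow_mul [IsGalois K L] [Fact p.Prime]
    (hdisc : ¬ (p : ℤ) ∣ discr K) [P.LiesOver (Ideal.span {(p : ℤ)})] {h : ℤ[X]}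
    {S : Finset (𝓞 L)} (hS : h.map (Int.castRingHom (𝓞 L)) = ∏ r ∈ S, (X - C r))
    (hndvd : ¬ (p : ℤ) ^ 2 ∣ h.coeff 0) {f : ℤ[X]} {V : Finset (𝓞 L)} (hVS : V ⊆ S) {β : 𝓞 L}
    (hβ : β ∈ P) (hV : f.map (Int.castRingHom (𝓞 L)) - C β = ∏ y ∈ V, (X - C y)) {k : ℕ}
    {c : ZMod p} (hc : c ≠ 0) (hf : f.map (Int.castRingHom (ZMod p)) = X ^ k * (X - C c)) :
    HasTransitiveStabilizerOn Gal(L/K) (V : Set (𝓞 L)) := by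
  obtain ⟨x₀, hx₀, hx₀P, mem_of_ne⟩ := exists_notMem_of_map_eq_X_pow_mul P hβ hV hc hf
  refine ⟨x₀, hx₀, fun y ⟨hy, hyx⟩ z ⟨hz, hzx⟩ => ?_⟩
  obtain ⟨σ, hσ, hσy⟩ := exists_mem_inertia_smul_eq (K := K) P hdisc hS hndvd (hVS hy)
    (mem_of_ne y hy hyx) (hVS hz) (mem_of_ne z hz hzx)
  have mem_iff := mem_iff_aeval_eq_of_map_sub_C_eq_prod hV
  have smul_β : σ • β = β := by
    rw [← (mem_iff y).1 hy, ← aeval_smul, hσy, (mem_iff z).1 hz, (mem_iff y).1 hy]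
  have smul_x₀ : σ • x₀ ∈ V := by
    rw [mem_iff, aeval_smul, (mem_iff x₀).1 hx₀, smul_β]
  refine ⟨⟨σ, ?_⟩, hσy⟩
  by_contra hne
  exact hx₀P (by simpa using P.sub_mem (mem_of_ne _ smul_x₀ hne) (hσ x₀))

theorem actsAsSwapOn_of_map_eq_X_sq_mul [IsGalois K L] [Fact p.Prime]
    (hdisc : ¬ (p : ℤ) ∣ discr K) {h : ℤ[X]} {S : Finset (𝓞 L)}
    (hS : h.map (Int.castRingHom (𝓞 L)) = ∏ r ∈ S, (X - C r))
    {Ψ : (ZMod p)[X]} (hh : h.map (Int.castRingHom (ZMod p)) = X ^ 2 * Ψ) (hsep : Ψ.Separable)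
    (h0 : Ψ.eval 0 ≠ 0) (hndvd : ¬ (p : ℤ) ^ 2 ∣ h.coeff 0) :
    ActsAsSwapOn Gal(L/K) (S : Set (𝓞 L)) := by
  obtain ⟨P, _, _⟩ := exists_isPrime_liesOver L p
  obtain ⟨a, ha, b, hb, hab, haP, hbP, eq_or_eq, injOn⟩ :=
    exists_pair_of_map_eq_X_sq_mul P hS hh hsep h0
  obtain ⟨τ, hτ, hτa⟩ := exists_mem_inertia_smul_eq (K := K) P hdisc hS hndvd ha haP hb hbP
  have smul_mem : ∀ z ∈ S, τ • z ∈ S := fun z hz => smul_mem_of_map_eq_prod hS τ hz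
  refine ⟨τ, a, ha, b, hb, hab, hτa, ?_, fun x hx hxa hxb => ?_⟩
  · have : τ • b ∈ P := by simpa using P.add_mem (hτ b) hbP
    exact (eq_or_eq _ (smul_mem b hb) this).resolve_right fun h =>
      hab (smul_left_cancel τ (hτa.trans h.symm))
  · have hxP : x ∉ P := fun h => (eq_or_eq x hx h).elim hxa hxb
    exact (injOn x hx _ (smul_mem x hx) hxP (by simpa using P.neg_mem (hτ x))).symm

end Inertia

section CompIterate

variable {R : Type*} [CommRing R]

/-- The polynomial `g ∘ f^m`, for `f^m` the `m`-th iterate of `f` under composition. -/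
noncomputable def compIterate (f g : R[X]) (m : ℕ) : R[X] := g.comp (f.comp^[m] X)

@[simp]
theorem compIterate_zero (f g : R[X]) : compIterate f g 0 = g := by
  simp [compIterate]

theorem comp_iterate_X_comp (f : R[X]) (k m : ℕ) :
    (f.comp^[k] X).comp (f.comp^[m] X) = f.comp^[k + m] X := by
  induction k with
  | zero => simp
  | succ k ih =>
    rw [Nat.add_right_comm, Function.iterate_succ_apply', Function.iterate_succ_apply', comp_assoc,
      ih]

theorem compIterate_succ (f g : R[X]) (m : ℕ) :
    compIterate f g (m + 1) = (compIterate f g m).comp f := by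
  simpa [compIterate, comp_assoc] using congrArg g.comp (comp_iterate_X_comp f m 1).symm

theorem eval_compIterate (f g : R[X]) (m : ℕ) (x : R) :
    (compIterate f g m).eval x = g.eval ((fun y => f.eval y)^[m] x) := by
  simp [compIterate, eval_comp]

theorem aeval_compIterate {A : Type*} [CommRing A] [Algebra R A] (f g : R[X]) (m : ℕ) (x : A) :
    aeval x (compIterate f g m) = aeval ((fun y => aeval y f)^[m] x) g := by
  simp [compIterate, aeval_def]

theorem map_iterate_comp {S : Type*} [CommRing S] (φ : R →+* S) (f : R[X]) (m : ℕ) :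
    (f.comp^[m] X).map φ = (f.map φ).comp^[m] X := by
  induction m with
  | zero => simp
  | succ m ih => rw [Function.iterate_succ_apply', Function.iterate_succ_apply', map_comp, ih]

theorem map_compIterate {S : Type*} [CommRing S] (φ : R →+* S) (f g : R[X]) (m : ℕ) :
    (compIterate f g m).map φ = compIterate (f.map φ) (g.map φ) m := by
  rw [compIterate, map_comp, map_iterate_comp, compIterate]

theorem natDegree_compIterate [NoZeroDivisors R] (f g : R[X]) (m : ℕ) :
    (compIterate f g m).natDegree = g.natDegree * f.natDegree ^ m := by
  nontriviality R
  simp [compIterate, natDegree_comp]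

theorem monic_compIterate [NoZeroDivisors R] {f g : R[X]} (hf : f.Monic) (hg : g.Monic)
    (hd : f.natDegree ≠ 0) (m : ℕ) : (compIterate f g m).Monic := by
  induction m with
  | zero => simpa using hg
  | succ m ih => exact compIterate_succ f g m ▸ ih.comp hf hd

theorem compIterate_X_pow (d e m : ℕ) :
    compIterate (X ^ d : R[X]) (X ^ e) m = X ^ (e * d ^ m) := by
  induction m with
  | zero => simp
  | succ m ih => rw [compIterate_succ, ih, X_pow_comp, ← pow_mul, pow_succ', mul_left_comm]

theorem dvd_coeff_zero_compIterate_sub {f : R[X]} (g : R[X]) {k : R} (hk : k ∣ f.coeff 0)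
    (m : ℕ) : k ∣ (compIterate f g m).coeff 0 - g.coeff 0 := by
  induction m with
  | zero => simp
  | succ m ih =>
    have step := sub_dvd_eval_sub (f.coeff 0) 0 (compIterate f g m)
    rw [sub_zero, ← coeff_zero_eq_eval_zero] at step
    rw [compIterate_succ, coeff_zero_eq_eval_zero (Polynomial.comp _ _), eval_comp,
      ← coeff_zero_eq_eval_zero f]
    simpa using dvd_add (hk.trans step) ih

theorem not_dvd_coeff_zero_compIterate {f g : R[X]} {k : R} (hf : k ∣ f.coeff 0)
    (hg : ¬ k ∣ g.coeff 0) (m : ℕ) : ¬ k ∣ (compIterate f g m).coeff 0 := fun h =>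
  hg ((dvd_iff_dvd_of_dvd_sub (dvd_coeff_zero_compIterate_sub g hf m)).1 h)

end CompIterate

section LocalConditions

/-- Monic integral polynomials `f` and `g` with the degrees of a polynomial of degree `d ≥ 2` and
its normalized derivative. -/
structure IsMonicPair (d : ℕ) (f g : ℤ[X]) : Prop where
  two_le : 2 ≤ d
  monic_left : f.Monic
  monic_right : g.Monic
  natDegree_left : f.natDegree = d
  natDegree_right : g.natDegree = d - 1

/-- Congruences modulo powers of `q` making every `g ∘ f^m` an Eisenstein polynomial at `q`. -/
structure TransitiveAt (d : ℕ) (f g : ℤ[X]) (q : ℕ) : Prop where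
  map_left : f.map (Int.castRingHom (ZMod q)) = X ^ d
  map_right : g.map (Int.castRingHom (ZMod q)) = X ^ (d - 1)
  sq_dvd_left : (q : ℤ) ^ 2 ∣ f.coeff 0
  not_sq_dvd_right : ¬ (q : ℤ) ^ 2 ∣ g.coeff 0

/-- Congruences modulo powers of `r` making inertia at `r` fix one root of `g`, and one point of a
fibre of `f`, and permute the others transitively. -/
structure DoublyTransitiveAt (d : ℕ) (f g : ℤ[X]) (r : ℕ) : Prop where
  map_left : f.map (Int.castRingHom (ZMod r)) = X ^ (d - 1) * (X - C (d : ZMod r))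
  map_right : g.map (Int.castRingHom (ZMod r)) = X ^ (d - 2) * (X - C (d - 1 : ZMod r))
  left_ne_zero : (d : ZMod r) ≠ 0
  right_ne_zero : (d - 1 : ZMod r) ≠ 0
  sq_dvd_left : (r : ℤ) ^ 2 ∣ f.coeff 0
  not_sq_dvd_right : ¬ (r : ℤ) ^ 2 ∣ g.coeff 0

/-- Congruences modulo powers of `p` making inertia at `p` act as a transposition on the roots of
`h`. -/
def SwapAt (h : ℤ[X]) (p : ℕ) : Prop :=
  ∃ Ψ : (ZMod p)[X], h.map (Int.castRingHom (ZMod p)) = X ^ 2 * Ψ ∧ Ψ.Separable ∧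
    Ψ.eval 0 ≠ 0 ∧ ¬ (p : ℤ) ^ 2 ∣ h.coeff 0

variable {d q r : ℕ} {f g : ℤ[X]}

namespace IsMonicPair

theorem natDegree_left_ne_zero (h : IsMonicPair d f g) : f.natDegree ≠ 0 := by
  have := h.two_le
  have := h.natDegree_left
  lia

theorem monic_compIterate (h : IsMonicPair d f g) (m : ℕ) : (compIterate f g m).Monic :=
  _root_.monic_compIterate h.monic_left h.monic_right h.natDegree_left_ne_zero m

theorem natDegree_compIterate (h : IsMonicPair d f g) (m : ℕ) :
    (compIterate f g m).natDegree = (d - 1) * d ^ m := by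
  rw [_root_.natDegree_compIterate, h.natDegree_left, h.natDegree_right]

end IsMonicPair

theorem TransitiveAt.map_compIterate (h : TransitiveAt d f g q) (m : ℕ) :
    (compIterate f g m).map (Int.castRingHom (ZMod q)) = X ^ ((d - 1) * d ^ m) := by
  rw [_root_.map_compIterate, h.map_left, h.map_right, compIterate_X_pow]

theorem TransitiveAt.not_sq_dvd_coeff_zero (h : TransitiveAt d f g q) (m : ℕ) :
    ¬ (q : ℤ) ^ 2 ∣ (compIterate f g m).coeff 0 :=
  not_dvd_coeff_zero_compIterate h.sq_dvd_left h.not_sq_dvd_right m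

theorem TransitiveAt.irreducible [Fact q.Prime] (h : TransitiveAt d f g q)
    (hfg : IsMonicPair d f g) (m : ℕ) : Irreducible (compIterate f g m) := by
  have hq : Prime (q : ℤ) := Nat.prime_iff_prime_int.1 Fact.out
  have hmonic := hfg.monic_compIterate m
  have heis : (compIterate f g m).IsEisensteinAt (Ideal.span {(q : ℤ)}) := by
    refine ⟨?_, fun {i} hi => ?_, ?_⟩
    · rw [hmonic.leadingCoeff, Ideal.mem_span_singleton]
      exact fun h => hq.not_isUnit (isUnit_of_dvd_one h)
    · rw [hfg.natDegree_compIterate] at hi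
      have := congrArg (fun F => F.coeff i) (h.map_compIterate m)
      rw [Ideal.mem_span_singleton, ← ZMod.intCast_zmod_eq_zero_iff_dvd]
      simpa [coeff_X_pow, hi.ne] using this
    · rw [Ideal.span_singleton_pow, Ideal.mem_span_singleton]
      exact h.not_sq_dvd_coeff_zero m
  refine heis.irreducible ((Ideal.span_singleton_prime hq.ne_zero).2 hq) hmonic.isPrimitive ?_
  have := hfg.two_le
  rw [hfg.natDegree_compIterate]
  exact Nat.mul_pos (by lia) (pow_pos (by lia) m)

theorem DoublyTransitiveAt.not_sq_dvd_coeff_zero (h : DoublyTransitiveAt d f g r) (m : ℕ) :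
    ¬ (r : ℤ) ^ 2 ∣ (compIterate f g m).coeff 0 :=
  not_dvd_coeff_zero_compIterate h.sq_dvd_left h.not_sq_dvd_right m

theorem DoublyTransitiveAt.dvd_coeff_zero (h : DoublyTransitiveAt d f g r) (hd : 3 ≤ d) (m : ℕ) :
    (r : ℤ) ∣ (compIterate f g m).coeff 0 := by
  have hg : (r : ℤ) ∣ g.coeff 0 := by
    have hd2 : 0 ≠ d - 2 := by lia
    rw [← ZMod.intCast_zmod_eq_zero_iff_dvd]
    simpa [mul_coeff_zero, coeff_X_pow, hd2] using congrArg (fun F => F.coeff 0) h.map_right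
  have hf := (dvd_pow_self (r : ℤ) two_ne_zero).trans h.sq_dvd_left
  exact (dvd_iff_dvd_of_dvd_sub (dvd_coeff_zero_compIterate_sub g hf m)).2 hg

end LocalConditions

section Splitting

theorem splits_of_splits_comp {F : Type*} [Field F] {p q : F[X]} (hq : q.natDegree ≠ 0)
    (h : (p.comp q).Splits) : p.Splits := by
  have h' : ((p.comp q).map (algebraMap F F)).Splits := by simpa using h
  simpa using (Gal.splits_in_splittingField_of_comp p q hq).of_algHom
    (SplittingField.lift (p.comp q) h')

theorem splits_compIterate_of_le {F : Type*} [Field F] {f g : F[X]} (hf : f.natDegree ≠ 0)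
    {m n : ℕ} (hmn : m ≤ n) (h : (compIterate f g n).Splits) : (compIterate f g m).Splits := by
  induction hmn using Nat.decreasingInduction with
  | self => exact h
  | of_succ k _ ih => exact splits_of_splits_comp hf (compIterate_succ f g k ▸ ih)

variable {A : Type*} [CommRing A] [IsDomain A]

theorem exists_eq_prod_X_sub_C {q : A[X]} (hq : q.Monic) (hsplit : q.Splits)
    (hnodup : q.roots.Nodup) : ∃ V : Finset A, q = ∏ y ∈ V, (X - C y) :=
  ⟨⟨q.roots, hnodup⟩, hsplit.eq_prod_roots_of_monic hq⟩

theorem exists_eq_prod_X_sub_C_of_dvd {S : Finset A} {q : A[X]} (hq : q.Monic)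
    (hdvd : q ∣ ∏ r ∈ S, (X - C r)) : ∃ V : Finset A, q = ∏ y ∈ V, (X - C y) := by
  have hne : ∏ r ∈ S, (X - C r) ≠ 0 := (monic_prod_X_sub_C _ _).ne_zero
  refine exists_eq_prod_X_sub_C hq ((Splits.prod fun r _ => .X_sub_C r).of_dvd hne hdvd) ?_
  exact Multiset.nodup_of_le (roots.le_of_dvd hne hdvd) (by rw [roots_prod_X_sub_C]; exact S.nodup)

theorem card_eq_natDegree_of_eq_prod_X_sub_C {S : Finset A} {q : A[X]}
    (h : q = ∏ r ∈ S, (X - C r)) : S.card = q.natDegree := by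
  simp [h]

theorem exists_map_ringOfIntegers_eq_prod {L : Type*} [Field L] [NumberField L] {h : ℤ[X]}
    (hm : h.Monic) (hirr : Irreducible h) (hsplit : (h.map (Int.castRingHom L)).Splits) :
    ∃ S : Finset (𝓞 L), h.map (Int.castRingHom (𝓞 L)) = ∏ r ∈ S, (X - C r) := by
  have hinj : Function.Injective (algebraMap (𝓞 L) L) := RingOfIntegers.coe_injective
  have hmap : (h.map (Int.castRingHom (𝓞 L))).map (algebraMap (𝓞 L) L) =
      h.map (Int.castRingHom L) := by
    rw [map_map]
    exact congrArg (h.map ·) (RingHom.ext_int _ _)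
  have hsplit' : (h.map (Int.castRingHom (𝓞 L))).Splits := by
    refine .of_splits_map_of_injective hinj (hmap ▸ hsplit) fun x hx => ?_
    rw [hmap, mem_roots (hm.map _).ne_zero, IsRoot.def, eval_map] at hx
    exact ⟨⟨x, h, hm, hx⟩, rfl⟩
  have hsep : (h.map (Int.castRingHom L)).Separable := by
    have := ((hm.irreducible_iff_irreducible_map_fraction_map (K := ℚ)).1 hirr).separable.map
      (f := algebraMap ℚ L)
    rwa [map_map, RingHom.ext_int ((algebraMap ℚ L).comp (algebraMap ℤ ℚ)) (Int.castRingHom L)]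
      at this
  refine exists_eq_prod_X_sub_C (hm.map _) hsplit' (.of_map (algebraMap (𝓞 L) L) ?_)
  rw [← hsplit'.roots_map_of_injective hinj, hmap]
  exact nodup_roots hsep

end Splitting

section GaloisTower

theorem hasTransitiveStabilizerOn_of_card_le_two {Γ A : Type*} [Group Γ] [MulAction Γ A]
    {V : Finset A} (hV : V.Nonempty) (hcard : V.card ≤ 2) :
    HasTransitiveStabilizerOn Γ (V : Set A) := by
  classical
  obtain ⟨x, hx⟩ := hV
  have hrest : (V.erase x).card ≤ 1 := by
    rw [Finset.card_erase_of_mem hx]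
    lia
  refine ⟨x, hx, fun y ⟨hy, hyx⟩ z ⟨hz, hzx⟩ => ⟨1, ?_⟩⟩
  rw [one_smul]
  exact Finset.card_le_one.1 hrest y (Finset.mem_erase.2 ⟨hyx, hy⟩) z
    (Finset.mem_erase.2 ⟨hzx, hz⟩)

/-- The finite sets `S m`, for `m ≤ n`, are the roots of `g ∘ f^m` in a ring over which these
polynomials split into distinct linear factors. -/
def IsRootTower {A : Type*} [CommRing A] (f g : ℤ[X]) (n : ℕ) (S : ℕ → Finset A) : Prop :=
  ∀ m ≤ n, (compIterate f g m).map (Int.castRingHom A) = ∏ r ∈ S m, (X - C r)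

theorem exists_isRootTower {L : Type*} [Field L] [NumberField L] {d n : ℕ} {f g : ℤ[X]}
    (hfg : IsMonicPair d f g) (hirr : ∀ m, Irreducible (compIterate f g m))
    (hsplit : ((compIterate f g n).map (Int.castRingHom L)).Splits) :
    ∃ S : ℕ → Finset (𝓞 L), IsRootTower f g n S := by
  choose! S hS using fun m (hm : m ≤ n) =>
    exists_map_ringOfIntegers_eq_prod (L := L) (hfg.monic_compIterate m) (hirr m) (by
      rw [map_compIterate] at hsplit ⊢
      refine splits_compIterate_of_le ?_ hm hsplit
      rw [hfg.monic_left.natDegree_map]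
      exact hfg.natDegree_left_ne_zero)
  exact ⟨S, hS⟩

namespace IsRootTower

section Domain

variable {A : Type*} [CommRing A] [IsDomain A] {f g : ℤ[X]} {d m n : ℕ} {S : ℕ → Finset A}

theorem mem_iff (h : IsRootTower f g n S) (hm : m ≤ n) (x : A) :
    x ∈ S m ↔ aeval ((fun y => aeval y f)^[m] x) g = 0 := by
  rw [mem_iff_aeval_eq_zero_of_map_eq_prod (h m hm), aeval_compIterate]

theorem preimage_eq (h : IsRootTower f g n S) (hm : m ≤ n) :
    (fun y => aeval y f)^[m] ⁻¹' {x : A | aeval x g = 0} = S m :=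
  Set.ext fun x => (h.mem_iff hm x).symm

theorem card_eq (h : IsRootTower f g n S) (hfg : IsMonicPair d f g) (hm : m ≤ n) :
    (S m).card = (d - 1) * d ^ m := by
  rw [card_eq_natDegree_of_eq_prod_X_sub_C (h m hm), (hfg.monic_compIterate m).natDegree_map,
    hfg.natDegree_compIterate]

theorem exists_fibre (h : IsRootTower f g n S) (hfg : IsMonicPair d f g) (hm : m < n) {x : A}
    (hx : x ∈ S m) : ∃ V ⊆ S (m + 1), f.map (Int.castRingHom A) - C x = ∏ y ∈ V, (X - C y) ∧
      V.card = d ∧ (fun y => aeval y f) ⁻¹' {x} = V := by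
  have hdeg : (f.map (Int.castRingHom A)).natDegree = d := by
    rw [hfg.monic_left.natDegree_map, hfg.natDegree_left]
  have hd : 0 < (f.map (Int.castRingHom A)).natDegree :=
    hdeg.symm ▸ two_pos.trans_le hfg.two_le
  have hmonic : (f.map (Int.castRingHom A) - C x).Monic := (hfg.monic_left.map _).sub_of_left
    (degree_C_le.trans_lt (natDegree_pos_iff_degree_pos.1 hd))
  have hdvd : f.map (Int.castRingHom A) - C x ∣ ∏ r ∈ S (m + 1), (X - C r) := by
    rw [← h (m + 1) hm, compIterate_succ, Polynomial.map_comp, h m hm.le, prod_comp]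
    simp only [sub_comp, X_comp, C_comp]
    exact Finset.dvd_prod_of_mem (fun r => f.map (Int.castRingHom A) - C r) hx
  obtain ⟨V, hV⟩ := exists_eq_prod_X_sub_C_of_dvd hmonic hdvd
  have mem_iff_aeval_eq := mem_iff_aeval_eq_of_map_sub_C_eq_prod hV
  refine ⟨V, fun y hy => ?_, hV, ?_, Set.ext fun y => (mem_iff_aeval_eq y).symm⟩
  · rwa [h.mem_iff hm, Function.iterate_succ_apply, (mem_iff_aeval_eq y).1 hy, ← h.mem_iff hm.le]
  · rw [card_eq_natDegree_of_eq_prod_X_sub_C hV, natDegree_sub_C, hdeg]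

end Domain

variable {K L : Type*} [Field K] [Field L] [NumberField K] [NumberField L] [Algebra K L]
  [IsGalois K L] {f g : ℤ[X]} {d m n p : ℕ} {S : ℕ → Finset (𝓞 L)}

theorem hasTransitiveStabilizerOn_base (h : IsRootTower f g n S) [Fact p.Prime]
    (hdisc : ¬ (p : ℤ) ∣ discr K) (hp : DoublyTransitiveAt d f g p) :
    HasTransitiveStabilizerOn Gal(L/K) (S 0 : Set (𝓞 L)) := by
  obtain ⟨P, _, _⟩ := exists_isPrime_liesOver L p
  have hS : g.map (Int.castRingHom (𝓞 L)) = ∏ r ∈ S 0, (X - C r) := by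
    simpa using h 0 (Nat.zero_le n)
  exact hasTransitiveStabilizerOn_of_map_eq_X_pow_mul P hdisc hS hp.not_sq_dvd_right subset_rfl
    P.zero_mem (by rw [C_0, sub_zero, hS]) hp.right_ne_zero hp.map_right

theorem exists_hasTransitiveStabilizerOn_fibre (h : IsRootTower f g n S)
    (hfg : IsMonicPair d f g) (hm : m < n) (hd : 3 ≤ d) [Fact p.Prime]
    (hdisc : ¬ (p : ℤ) ∣ discr K) (hp : DoublyTransitiveAt d f g p) :
    ∃ x ∈ S m, HasTransitiveStabilizerOn Gal(L/K) ((fun y : 𝓞 L => aeval y f) ⁻¹' {x}) := by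
  obtain ⟨P, hP, _⟩ := exists_isPrime_liesOver L p
  obtain ⟨x, hx, hxP⟩ : ∃ x ∈ S m, x ∈ P := by
    have hprod := (intCast_mem_iff_dvd_of_liesOver P _).2 (hp.dvd_coeff_zero hd m)
    rw [coeff_zero_eq_prod_neg (h m hm.le), hP.prod_mem_iff] at hprod
    simpa using hprod
  obtain ⟨V, hVS, hV, -, hfibre⟩ := h.exists_fibre hfg hm hx
  refine ⟨x, hx, ?_⟩
  rw [hfibre]
  exact hasTransitiveStabilizerOn_of_map_eq_X_pow_mul P hdisc (h (m + 1) hm)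
    (hp.not_sq_dvd_coeff_zero (m + 1)) hVS hxP hV hp.left_ne_zero hp.map_left

end IsRootTower

/-- Primes not dividing `D` which certify, one level at a time, that the Galois group acts on the
roots of `g ∘ f^n` as the full iterated wreath product. -/
structure HasWitnessPrimes (D : ℤ) (d n : ℕ) (f g : ℤ[X]) : Prop where
  transitive : ∃ q : ℕ, q.Prime ∧ ¬ (q : ℤ) ∣ D ∧ TransitiveAt d f g q
  doublyTransitive : 3 ≤ d → ∃ r : ℕ, r.Prime ∧ ¬ (r : ℤ) ∣ D ∧ DoublyTransitiveAt d f g r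
  swap : ∀ m ≤ n, (m = 0 → 3 ≤ d) →
    ∃ p : ℕ, p.Prime ∧ ¬ (p : ℤ) ∣ D ∧ SwapAt (compIterate f g m) p

namespace IsRootTower

variable {K L : Type*} [Field K] [Field L] [NumberField K] [NumberField L] [Algebra K L]
  [IsGalois K L] {f g : ℤ[X]} {d m n : ℕ} {S : ℕ → Finset (𝓞 L)}

theorem isTransitiveOn (h : IsRootTower f g n S) (hfg : HasWitnessPrimes (discr K) d n f g)
    (hm : m ≤ n) : IsTransitiveOn Gal(L/K) (S m : Set (𝓞 L)) := by
  obtain ⟨q, hq, hdisc, htrans⟩ := hfg.transitive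
  have := Fact.mk hq
  exact isTransitiveOn_of_map_eq_X_pow hdisc (h m hm) (htrans.map_compIterate m)
    (htrans.not_sq_dvd_coeff_zero m)

theorem base_stabilizer (h : IsRootTower f g n S) (hfg : IsMonicPair d f g)
    (hprimes : HasWitnessPrimes (discr K) d n f g) :
    HasTransitiveStabilizerOn Gal(L/K) (S 0 : Set (𝓞 L)) := by
  rcases lt_or_ge d 3 with hd | hd
  · have hcard := h.card_eq hfg (Nat.zero_le n)
    have := hfg.two_le
    rw [pow_zero, mul_one] at hcard
    exact hasTransitiveStabilizerOn_of_card_le_two (Finset.card_pos.1 (by lia)) (by lia)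
  · obtain ⟨r, hr, hdisc, hdouble⟩ := hprimes.doublyTransitive hd
    have := Fact.mk hr
    exact h.hasTransitiveStabilizerOn_base hdisc hdouble

theorem fibre_stabilizer (h : IsRootTower f g n S) (hfg : IsMonicPair d f g)
    (hprimes : HasWitnessPrimes (discr K) d n f g) (hm : m < n) :
    ∃ x ∈ S m, HasTransitiveStabilizerOn Gal(L/K) ((fun y : 𝓞 L => aeval y f) ⁻¹' {x}) := by
  rcases lt_or_ge d 3 with hd | hd
  · have := hfg.two_le
    obtain ⟨x, hx⟩ : (S m).Nonempty := by
      rw [← Finset.card_pos, h.card_eq hfg hm.le]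
      exact Nat.mul_pos (by lia) (pow_pos (by lia) m)
    obtain ⟨V, -, -, hcard, hfibre⟩ := h.exists_fibre hfg hm hx
    refine ⟨x, hx, ?_⟩
    rw [hfibre]
    exact hasTransitiveStabilizerOn_of_card_le_two (Finset.card_pos.1 (by lia)) (by lia)
  · obtain ⟨r, hr, hdisc, hdouble⟩ := hprimes.doublyTransitive hd
    have := Fact.mk hr
    exact h.exists_hasTransitiveStabilizerOn_fibre hfg hm hd hdisc hdouble

theorem actsAsSwapOn (h : IsRootTower f g n S) (hfg : IsMonicPair d f g)
    (hprimes : HasWitnessPrimes (discr K) d n f g) (hm : m ≤ n)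
    (hS : (S m : Set (𝓞 L)).Nontrivial) : ActsAsSwapOn Gal(L/K) (S m : Set (𝓞 L)) := by
  obtain ⟨p, hp, hdisc, Ψ, hΨ, hsep, h0, hndvd⟩ := hprimes.swap m hm fun hm0 => by
    have := Finset.one_lt_card_iff_nontrivial.2 hS
    rw [h.card_eq hfg hm, hm0, pow_zero] at this
    lia
  have := Fact.mk hp
  exact actsAsSwapOn_of_map_eq_X_sq_mul hdisc (h m hm) hΨ hsep h0 hndvd

theorem isFullTower (h : IsRootTower f g n S) (hfg : IsMonicPair d f g)
    (hprimes : HasWitnessPrimes (discr K) d n f g) :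
    IsFullTower Gal(L/K) (fun y : 𝓞 L => aeval y f) {x | aeval x g = 0} d n where
  map_smul σ x := aeval_smul f σ x
  smul_mem σ x hx := by
    rw [Set.mem_ofPred_eq] at hx ⊢
    rw [aeval_smul, hx, smul_zero]
  nonempty_equiv m hm x hx := by
    obtain ⟨V, -, -, hcard, hfibre⟩ := h.exists_fibre hfg hm ((h.mem_iff hm.le x).2 hx)
    exact ⟨(V.equivFinOfCardEq hcard).symm.trans (Equiv.setCongr hfibre.symm)⟩
  isTransitiveOn m hm := by
    rw [h.preimage_eq hm]
    exact h.isTransitiveOn hprimes hm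
  base_stabilizer := by
    have hbase := h.preimage_eq (Nat.zero_le n)
    rw [Function.iterate_zero, Set.preimage_id] at hbase
    rw [hbase]
    exact h.base_stabilizer hfg hprimes
  fibre_stabilizer m hm := by
    obtain ⟨x, hx, hstab⟩ := h.fibre_stabilizer hfg hprimes hm
    exact ⟨x, (h.mem_iff hm.le x).1 hx, hstab⟩
  actsAsSwapOn m hm := by
    rw [h.preimage_eq hm]
    exact h.actsAsSwapOn hfg hprimes hm

end IsRootTower

theorem eq_one_of_forall_smul_root_eq {K L : Type*} [Field K] [Field L] [Algebra K L]
    {h : ℤ[X]} (hh : h.Monic) [IsSplittingField K L (h.map (Int.castRingHom K))]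
    {σ : Gal(L/K)} (hσ : ∀ x : 𝓞 L, aeval x h = 0 → σ • x = x) : σ = 1 := by
  have hadjoin := IsSplittingField.adjoin_rootSet L (h.map (Int.castRingHom K))
  suffices (σ : L →ₐ[K] L) = AlgHom.id K L from AlgEquiv.ext fun x => DFunLike.congr_fun this x
  refine AlgHom.ext_of_adjoin_eq_top hadjoin fun x hx => ?_
  have hx0 : aeval x h = 0 := by
    have := (mem_rootSet.1 hx).2
    rwa [← algebraMap_int_eq, aeval_map_algebraMap] at this
  let y : 𝓞 L := ⟨x, h, hh, hx0⟩
  have hy : aeval y h = 0 := RingOfIntegers.coe_injective (by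
    rw [← aeval_algebraMap_apply, map_zero]
    exact hx0)
  exact congrArg (algebraMap (𝓞 L) L) (hσ y hy)

theorem nonempty_gal_mulEquiv_symWreath {K L : Type*} [Field K] [Field L] [NumberField K]
    [NumberField L] [Algebra K L] [IsGalois K L] {d n : ℕ} {f g : ℤ[X]}
    [IsSplittingField K L ((compIterate f g n).map (Int.castRingHom K))]
    (hfg : IsMonicPair d f g) (hprimes : HasWitnessPrimes (discr K) d n f g) :
    Nonempty (Gal(L/K) ≃* SymWreath (d - 1) (iteratedSymWreath d n)) := by
  obtain ⟨q, hq, -, htrans⟩ := hprimes.transitive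
  have := Fact.mk hq
  obtain ⟨S, hS⟩ := exists_isRootTower (L := L) (n := n) hfg (htrans.irreducible hfg) (by
    have := IsSplittingField.splits L ((compIterate f g n).map (Int.castRingHom K))
    rwa [map_map, RingHom.ext_int ((algebraMap K L).comp _) (Int.castRingHom L)] at this)
  have hcard : (S 0).card = d - 1 := by simpa using hS.card_eq hfg (Nat.zero_le n)
  have hbase : {x : 𝓞 L | aeval x g = 0} = S 0 := hS.preimage_eq (Nat.zero_le n)
  refine (hS.isFullTower hfg hprimes).nonempty_mulEquiv_symWreath hfg.two_le
    (((S 0).equivFinOfCardEq hcard).symm.trans (Equiv.setCongr hbase.symm)) fun σ hσ => ?_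
  exact eq_one_of_forall_smul_root_eq (hfg.monic_compIterate n) fun x hx =>
    hσ x (by rwa [aeval_compIterate] at hx)

end GaloisTower

section CriticalOrbit

/-- Monic integral polynomials `F` of degree `d ≥ 2` and `g` squarefree with `F' = d g`, such that
`0` is a critical point of `F` fixed by `F`. -/
structure IsCriticalPair (d : ℕ) (F g : ℤ[X]) : Prop where
  two_le : 2 ≤ d
  monic : F.Monic
  natDegree_eq : F.natDegree = d
  derivative_eq : derivative F = C (d : ℤ) * g
  separable : (g.map (Int.castRingHom ℂ)).Separable
  eval_zero_left : F.eval 0 = 0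
  eval_zero_right : g.eval 0 = 0

/-- The polynomial in the parameter `t` giving the value at `0` of the `m`-th iterate of
`F + t`. -/
noncomputable def critOrbit (F : ℤ[X]) : ℕ → ℤ[X]
  | 0 => 0
  | m + 1 => F.comp (critOrbit F m) + X

theorem aeval_critOrbit {R : Type*} [CommRing R] (F : ℤ[X]) (m : ℕ) (τ : R) :
    aeval τ (critOrbit F m) = (fun x => (F.map (Int.castRingHom R) + C τ).eval x)^[m] 0 := by
  induction m with
  | zero => simp [critOrbit]
  | succ m ih =>
    rw [Function.iterate_succ_apply', ← ih, critOrbit, map_add, aeval_comp, aeval_X, eval_add,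
      eval_C, eval_map]
    rfl

theorem eval_critOrbit (F : ℤ[X]) (m : ℕ) (t : ℤ) :
    (critOrbit F m).eval t = (fun x => (F + C t).eval x)^[m] 0 := by
  simpa using aeval_critOrbit F m t

theorem not_monic_dvd_of_dvd_sub_one {d : ℕ} (hd : 2 ≤ d) {h Q : ℤ[X]} (hm : h.Monic)
    (hdeg : h.natDegree ≠ 0) (hQ : C (d : ℤ) ∣ Q - 1) : ¬ h ∣ Q := by
  rintro ⟨w, rfl⟩
  obtain ⟨ℓ, hℓ, hℓd⟩ := Nat.exists_prime_and_dvd (show d ≠ 1 by lia)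
  have : Fact ℓ.Prime := ⟨hℓ⟩
  obtain ⟨v, hv⟩ := hQ
  have hd0 : (d : (ZMod ℓ)[X]) = 0 := by
    rw [← C_eq_natCast, (ZMod.natCast_eq_zero_iff d ℓ).2 hℓd, C_0]
  have hunit : h.map (Int.castRingHom (ZMod ℓ)) * w.map (Int.castRingHom (ZMod ℓ)) = 1 := by
    simpa [hd0, sub_eq_zero] using congrArg (Polynomial.map (Int.castRingHom (ZMod ℓ))) hv
  have hone := (hm.map (Int.castRingHom (ZMod ℓ))).eq_one_of_isUnit (.of_mul_eq_one _ hunit)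
  rw [← hm.natDegree_map (Int.castRingHom (ZMod ℓ)), hone, natDegree_one] at hdeg
  exact hdeg rfl

namespace IsCriticalPair

variable {d : ℕ} {F g : ℤ[X]}

theorem monic_and_natDegree_critOrbit (h : IsCriticalPair d F g) (m : ℕ) :
    (critOrbit F (m + 1)).Monic ∧ (critOrbit F (m + 1)).natDegree = d ^ m := by
  have hd := h.two_le
  induction m with
  | zero =>
    have : critOrbit F 1 = X := by simp [critOrbit, h.eval_zero_left]
    simp [this, monic_X]
  | succ m ih =>
    have hdeg : (F.comp (critOrbit F (m + 1))).natDegree = d ^ (m + 1) := by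
      rw [natDegree_comp, ih.2, h.natDegree_eq, pow_succ']
    have hmonic : (F.comp (critOrbit F (m + 1))).Monic :=
      h.monic.comp ih.1 (ih.2 ▸ pow_ne_zero _ (by lia))
    have hlt : (X : ℤ[X]).natDegree < (F.comp (critOrbit F (m + 1))).natDegree := by
      rw [hdeg, natDegree_X]
      exact Nat.one_lt_pow (by lia) (by lia)
    rw [critOrbit]
    exact ⟨hmonic.add_of_left (degree_lt_degree hlt),
      by rw [natDegree_add_eq_left_of_natDegree_lt hlt, hdeg]⟩

theorem monic_critOrbit (h : IsCriticalPair d F g) (m : ℕ) : (critOrbit F (m + 1)).Monic :=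
  (h.monic_and_natDegree_critOrbit m).1

theorem natDegree_critOrbit (h : IsCriticalPair d F g) (m : ℕ) :
    (critOrbit F (m + 1)).natDegree = d ^ m :=
  (h.monic_and_natDegree_critOrbit m).2

theorem dvd_derivative_critOrbit_sub_one (h : IsCriticalPair d F g) (m : ℕ) :
    C (d : ℤ) ∣ derivative (critOrbit F (m + 1)) - 1 := by
  rw [critOrbit, derivative_add, derivative_X, add_sub_cancel_right, derivative_comp,
    h.derivative_eq, mul_comp, C_comp]
  exact (dvd_mul_right _ _).mul_left _

/-- A multiple root would be an algebraic integer whose minimal polynomial divides a polynomial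
congruent to `1` modulo `d`. -/
theorem separable_critOrbit (h : IsCriticalPair d F g) (m : ℕ) :
    ((critOrbit F (m + 1)).map (Int.castRingHom ℂ)).Separable := by
  rw [Polynomial.Separable, isCoprime_iff_aeval_ne_zero_of_isAlgClosed ℂ ℂ]
  intro t
  by_contra! hroot
  rw [derivative_map, ← algebraMap_int_eq, aeval_map_algebraMap, aeval_map_algebraMap] at hroot
  have hint : IsIntegral ℤ t := ⟨_, h.monic_critOrbit m, hroot.1⟩
  exact not_monic_dvd_of_dvd_sub_one h.two_le (minpoly.monic hint) (minpoly.natDegree_pos hint).ne'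
    (h.dvd_derivative_critOrbit_sub_one m) (minpoly.isIntegrallyClosed_dvd hint hroot.2)

/-- The `d ^ m` distinct roots of the `(m + 1)`-st critical orbit polynomial cannot all be roots of
earlier ones, which have degrees `1, d, …, d ^ (m - 1)`. -/
theorem exists_exact_period (h : IsCriticalPair d F g) (m : ℕ) :
    ∃ t : ℂ, aeval t (critOrbit F (m + 1)) = 0 ∧ ∀ l < m, aeval t (critOrbit F (l + 1)) ≠ 0 := by
  classical
  by_contra! hcon
  let D : ℤ[X] := ∏ l ∈ Finset.range m, critOrbit F (l + 1)
  have hD : D.Monic := monic_prod_of_monic _ _ fun l _ => h.monic_critOrbit l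
  have hDdeg : D.natDegree < d ^ m := by
    rw [natDegree_prod_of_monic _ _ fun l _ => h.monic_critOrbit l,
      Finset.sum_congr rfl fun l _ => h.natDegree_critOrbit l]
    exact Nat.geomSum_lt h.two_le fun l => Finset.mem_range.1
  have hsub : ((critOrbit F (m + 1)).map (Int.castRingHom ℂ)).roots.toFinset ⊆
      (D.map (Int.castRingHom ℂ)).roots.toFinset := by
    intro t ht
    rw [Multiset.mem_toFinset, mem_roots ((h.monic_critOrbit m).map _).ne_zero, IsRoot.def,
      eval_map] at ht
    obtain ⟨l, hl, hroot⟩ := hcon t ht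
    rw [Multiset.mem_toFinset, mem_roots (hD.map _).ne_zero, IsRoot.def, eval_map]
    change aeval t D = 0
    rw [map_prod]
    exact Finset.prod_eq_zero (Finset.mem_range.2 hl) hroot
  have hcard := (Finset.card_le_card hsub).trans
    ((Multiset.toFinset_card_le _).trans (card_roots' _))
  rw [Multiset.toFinset_card_of_nodup (nodup_roots (h.separable_critOrbit m)),
    ← (IsAlgClosed.splits _).natDegree_eq_card_roots, (h.monic_critOrbit m).natDegree_map,
    hD.natDegree_map, h.natDegree_critOrbit] at hcard
  lia

end IsCriticalPair

end CriticalOrbit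

section Dynamics

theorem derivative_iterate_comp {R : Type*} [CommRing R] (f : R[X]) (m : ℕ) :
    derivative (f.comp^[m] X) = ∏ l ∈ Finset.range m, (derivative f).comp (f.comp^[l] X) := by
  induction m with
  | zero => simp
  | succ m ih =>
    rw [Function.iterate_succ_apply', derivative_comp, ih, Finset.prod_range_succ]

theorem derivative_compIterate {R : Type*} [CommRing R] (f g : R[X]) (m : ℕ) :
    derivative (compIterate f g m) = (∏ l ∈ Finset.range m, (derivative f).comp (f.comp^[l] X)) *
      (derivative g).comp (f.comp^[m] X) := by
  rw [compIterate, derivative_comp, derivative_iterate_comp]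

theorem coeff_one_compIterate {R : Type*} [CommRing R] {f : R[X]} (g : R[X])
    (hf : (derivative f).eval 0 = 0) (m : ℕ) : (compIterate f g (m + 1)).coeff 1 = 0 := by
  have h := coeff_derivative (compIterate f g (m + 1)) 0
  rw [coeff_zero_eq_eval_zero, derivative_compIterate, Finset.prod_range_succ'] at h
  simpa [hf] using h.symm

variable {k : Type*} [Field k] {d : k} {f g : k[X]} {m : ℕ}

/-- The forward orbit under `f` of a nonzero root of `g` meets no further root of `g`. -/
def OrbitsAvoidRoots (f g : k[X]) : Prop :=
  ∀ α, α ≠ 0 → g.eval α = 0 → ∀ l, g.eval ((fun x => f.eval x)^[l + 1] α) ≠ 0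

theorem OrbitsAvoidRoots.eval_iterate_zero_ne_zero (hfg : OrbitsAvoidRoots f g)
    (hg : g.eval 0 = 0) (hper : (fun x => f.eval x)^[m + 1] 0 = 0)
    (hexact : ∀ l < m, (fun x => f.eval x)^[l + 1] 0 ≠ 0) {l : ℕ} (hl : l < m) :
    g.eval ((fun x => f.eval x)^[l + 1] 0) ≠ 0 := fun h => by
  refine hfg _ (hexact l hl) h (m - l - 1) ?_
  rw [← Function.iterate_add_apply, show m - l - 1 + 1 + (l + 1) = m + 1 by lia, hper, hg]

theorem OrbitsAvoidRoots.eq_zero_of_multiple_root (hfg : OrbitsAvoidRoots f g)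
    (hf : derivative f = C d * g) (hd : d ≠ 0) (hg : g.eval 0 = 0) (hsep : g.Separable)
    (hper : (fun x => f.eval x)^[m + 1] 0 = 0)
    (hexact : ∀ l < m, (fun x => f.eval x)^[l + 1] 0 ≠ 0) {x : k}
    (hx : (compIterate f g (m + 1)).eval x = 0)
    (hx' : (derivative (compIterate f g (m + 1))).eval x = 0) : x = 0 := by
  let φ : k → k := fun x => f.eval x
  rw [eval_compIterate] at hx
  have hsimple : (derivative g).eval (φ^[m + 1] x) ≠ 0 :=
    hsep.eval₂_derivative_ne_zero (RingHom.id k) hx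
  have hor : (∃ l ≤ m, g.eval (φ^[l] x) = 0) ∨ (derivative g).eval (φ^[m + 1] x) = 0 := by
    simpa [derivative_compIterate, eval_prod, eval_comp, Finset.prod_eq_zero_iff, hf, hd, φ,
      Nat.lt_succ_iff] using hx'
  obtain ⟨l, hl, hgl⟩ := hor.resolve_right hsimple
  have hroot : g.eval (φ^[m - l + 1] (φ^[l] x)) = 0 := by
    rwa [← Function.iterate_add_apply, show m - l + 1 + l = m + 1 by lia]
  have hxl : φ^[l] x = 0 := by_contra fun h => hfg _ h hgl _ hroot
  rcases Nat.eq_zero_or_pos l with rfl | hpos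
  · exact hxl
  · rw [hxl] at hroot
    exact absurd hroot (hfg.eval_iterate_zero_ne_zero hg hper hexact (by lia))

theorem OrbitsAvoidRoots.eval_zero_cofactor_ne_zero (hfg : OrbitsAvoidRoots f g)
    (hf : derivative f = C d * g) (hd : d ≠ 0) (hg : g.eval 0 = 0) (hsep : g.Separable)
    (hper : (fun x => f.eval x)^[m + 1] 0 = 0)
    (hexact : ∀ l < m, (fun x => f.eval x)^[l + 1] 0 ≠ 0) {Ψ : k[X]}
    (hΨ : compIterate f g (m + 1) = X ^ 2 * Ψ) : Ψ.eval 0 ≠ 0 := by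
  have hsimple : (derivative g).eval 0 ≠ 0 := hsep.eval₂_derivative_ne_zero (RingHom.id k) hg
  let W : k[X] := (∏ l ∈ Finset.range m, (derivative f).comp (f.comp^[l + 1] X)) *
    (derivative g).comp (f.comp^[m + 1] X)
  have hder : derivative (compIterate f g (m + 1)) = C d * g * W := by
    simp only [derivative_compIterate, Finset.prod_range_succ', Function.iterate_zero, id_eq,
      comp_X, hf, W]
    ring
  have hW : W.eval 0 ≠ 0 := by
    have hcrit : ∀ l < m, g.eval ((fun x => f.eval x)^[l] (f.eval 0)) ≠ 0 := fun l hl =>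
      hfg.eval_iterate_zero_ne_zero hg hper hexact hl
    rw [Function.iterate_succ_apply] at hper
    simpa [W, eval_prod, eval_comp, Finset.prod_eq_zero_iff, hf, hd, hper, hsimple] using hcrit
  have hsecond : 2 * Ψ.eval 0 = d * (derivative g).eval 0 * W.eval 0 := by
    have := congrArg (fun P => (derivative P).eval 0) (hΨ ▸ hder)
    simpa [hg, one_add_one_eq_two] using this
  exact right_ne_zero_of_mul (hsecond ▸ mul_ne_zero (mul_ne_zero hd hsimple) hW)

theorem OrbitsAvoidRoots.separable_cofactor [IsAlgClosed k] (hfg : OrbitsAvoidRoots f g)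
    (hf : derivative f = C d * g) (hd : d ≠ 0) (hg : g.eval 0 = 0) (hsep : g.Separable)
    (hper : (fun x => f.eval x)^[m + 1] 0 = 0)
    (hexact : ∀ l < m, (fun x => f.eval x)^[l + 1] 0 ≠ 0) {Ψ : k[X]}
    (hΨ : compIterate f g (m + 1) = X ^ 2 * Ψ) : Ψ.Separable := by
  rw [Polynomial.Separable, isCoprime_iff_aeval_ne_zero_of_isAlgClosed k k]
  intro x
  by_contra! hroot
  simp only [coe_aeval_eq_eval] at hroot
  have hx : x = 0 := hfg.eq_zero_of_multiple_root hf hd hg hsep hper hexact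
    (by simp [hΨ, hroot.1]) (by simp [hΨ, hroot.1, hroot.2])
  exact hfg.eval_zero_cofactor_ne_zero hf hd hg hsep hper hexact hΨ (hx ▸ hroot.1)

end Dynamics

section Specialization

theorem isCoprime_map_iff_resultant_ne_zero {S k : Type*} [CommRing S] [Field k] {f : S[X]}
    (hf : f.Monic) (g : S[X]) (e : S →+* k) :
    IsCoprime (f.map e) (g.map e) ↔ e (f.resultant g) ≠ 0 := by
  obtain ⟨c, hc⟩ := Nat.exists_eq_add_of_le (natDegree_map_le (f := e) (p := g))
  have hres : e (f.resultant g) = (f.map e).resultant (g.map e) := by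
    rw [← resultant_map_map, hc, resultant_add_right_deg _ _ _ _ _ le_rfl,
      ← hf.natDegree_map e, coeff_natDegree, (hf.map e).leadingCoeff, one_pow, one_mul]
  rw [← isUnit_resultant_iff_isCoprime (hf.map e), isUnit_iff_ne_zero, hres]

theorem separable_map_iff_resultant_ne_zero {S k : Type*} [CommRing S] [Field k] {f : S[X]}
    (hf : f.Monic) (e : S →+* k) :
    (f.map e).Separable ↔ e (f.resultant (derivative f)) ≠ 0 := by
  rw [Polynomial.Separable, derivative_map, isCoprime_map_iff_resultant_ne_zero hf]

theorem exists_natAbs_eval_mul_ne {h : ℤ[X]} (hdeg : h.natDegree ≠ 0) {N : ℤ} (hN : N ≠ 0)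
    (c : ℕ) : ∃ y, (h.eval (N * y)).natAbs ≠ c := by
  by_contra! hcon
  have hconst : h.comp (C N * X) ^ 2 = C ((c : ℤ) ^ 2) := by
    refine Polynomial.funext fun y => ?_
    rw [← hcon y, Int.natCast_natAbs, sq_abs]
    simp [eval_comp]
  have hzero := congrArg natDegree hconst
  rw [natDegree_pow, natDegree_comp, natDegree_C_mul_X _ hN, natDegree_C] at hzero
  lia

/-- Schur: one evaluates at a multiple of `h(0) B!`, where `h` takes a value `h(0) u` with
`u ≡ 1` modulo `B!`. -/
theorem exists_prime_gt_dvd_eval {h : ℤ[X]} (hdeg : h.natDegree ≠ 0) (B : ℕ) :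
    ∃ p : ℕ, B < p ∧ p.Prime ∧ ∃ a : ℤ, (p : ℤ) ∣ h.eval a := by
  by_cases h0 : h.eval 0 = 0
  · obtain ⟨p, hp, hpp⟩ := Nat.exists_infinite_primes (B + 1)
    exact ⟨p, hp, hpp, 0, by simp [h0]⟩
  have hB : (B.factorial : ℤ) ≠ 0 := by exact_mod_cast B.factorial_ne_zero
  obtain ⟨y, hy⟩ := exists_natAbs_eval_mul_ne hdeg (mul_ne_zero h0 hB) (h.eval 0).natAbs
  obtain ⟨w, hw⟩ := sub_dvd_eval_sub (h.eval 0 * B.factorial * y) 0 h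
  set u : ℤ := 1 + B.factorial * (y * w) with hu
  have hval : h.eval (h.eval 0 * B.factorial * y) = h.eval 0 * u := by
    rw [sub_zero, sub_eq_iff_eq_add] at hw
    rw [hw, hu]
    ring
  have hu1 : u.natAbs ≠ 1 := fun hu1 => hy (by rw [hval, Int.natAbs_mul, hu1, mul_one])
  obtain ⟨p, hp, hpu⟩ := Nat.exists_prime_and_dvd hu1
  rw [← Int.natCast_dvd] at hpu
  refine ⟨p, ?_, hp, _, hval ▸ hpu.mul_left _⟩
  by_contra! hle
  have hpB : (p : ℤ) ∣ B.factorial := Int.natCast_dvd_natCast.2 (hp.dvd_factorial.2 hle)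
  exact (Nat.prime_iff_prime_int.1 hp).not_isUnit
    (isUnit_of_dvd_one ((dvd_add_left (hpB.mul_right _)).1 hpu))

theorem exists_prime_specialization {t : ℂ} (ht : IsIntegral ℤ t) {δ : ℤ[X]}
    (hδ : aeval t δ ≠ 0) (B : ℕ) :
    ∃ p : ℕ, B < p ∧ p.Prime ∧ ∃ a : ℤ, (∀ Q : ℤ[X], aeval t Q = 0 → (p : ℤ) ∣ Q.eval a) ∧
      ¬ (p : ℤ) ∣ δ.eval a := by
  have hmonic : (minpoly ℤ t).Monic := minpoly.monic ht
  have hcop : IsCoprime ((minpoly ℤ t).map (algebraMap ℤ ℚ)) (δ.map (algebraMap ℤ ℚ)) := by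
    rwa [← minpoly.isIntegrallyClosed_eq_field_fractions' ℚ ht,
      (minpoly.irreducible ht.tower_top).coprime_iff_not_dvd, minpoly.dvd_iff,
      aeval_map_algebraMap]
  have hres : (minpoly ℤ t).resultant δ ≠ 0 := fun h0 =>
    (isCoprime_map_iff_resultant_ne_zero hmonic δ _).1 hcop (by rw [h0, map_zero])
  obtain ⟨p, hpB, hp, a, ha⟩ := exists_prime_gt_dvd_eval (minpoly.natDegree_pos ht).ne'
    (max B ((minpoly ℤ t).resultant δ).natAbs)
  have : Fact p.Prime := ⟨hp⟩
  refine ⟨p, (le_max_left _ _).trans_lt hpB, hp, a, fun Q hQ => ?_, fun hpδ => ?_⟩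
  · exact ha.trans (eval_dvd (minpoly.isIntegrallyClosed_dvd ht hQ))
  · have hpres : ¬ (p : ℤ) ∣ (minpoly ℤ t).resultant δ := fun h =>
      hpB.not_ge ((Nat.le_of_dvd (Int.natAbs_pos.2 hres) (Int.natCast_dvd.1 h)).trans
        (le_max_right _ _))
    have hcop_p := (isCoprime_map_iff_resultant_ne_zero hmonic δ (Int.castRingHom (ZMod p))).2
      ((ZMod.intCast_zmod_eq_zero_iff_dvd _ p).not.2 hpres)
    rw [← ZMod.intCast_zmod_eq_zero_iff_dvd] at ha hpδ
    obtain ⟨u, v, huv⟩ := hcop_p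
    simpa [ha, hpδ] using congrArg (eval (a : ZMod p)) huv

theorem exists_not_sq_dvd_eval {p : ℕ} (hp : p.Prime) {Q : ℤ[X]} {a : ℤ}
    (hQ' : ¬ (p : ℤ) ∣ (derivative Q).eval a) :
    ∃ t : ℤ, (p : ℤ) ∣ t - a ∧ ¬ (p : ℤ) ^ 2 ∣ Q.eval t := by
  by_cases h : (p : ℤ) ^ 2 ∣ Q.eval a
  · refine ⟨a + p, by simp, fun h' => hQ' ?_⟩
    obtain ⟨z, hz⟩ := binomExpansion Q a p
    rw [hz, dvd_add_left (dvd_mul_left _ z), dvd_add_right h, pow_two] at h'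
    exact Int.dvd_of_mul_dvd_mul_right (by exact_mod_cast hp.ne_zero) h'
  · exact ⟨a, by simp, h⟩

end Specialization

section Transfer

theorem monic_divX {R : Type*} [CommRing R] {h : R[X]} (hh : h.Monic) (hdeg : h.natDegree ≠ 0) :
    h.divX.Monic := by
  rw [Polynomial.Monic, Polynomial.leadingCoeff, natDegree_divX_eq_natDegree_tsub_one, coeff_divX,
    Nat.sub_add_cancel (Nat.pos_of_ne_zero hdeg)]
  exact hh

theorem eq_X_sq_mul_divX_divX {R : Type*} [CommRing R] {h : R[X]} (h1 : h.coeff 1 = 0) :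
    h = X ^ 2 * h.divX.divX + C (h.coeff 0) := by
  conv_lhs => rw [← divX_mul_X_add h, ← divX_mul_X_add h.divX]
  rw [coeff_divX, zero_add, h1, C_0]
  ring

theorem dvd_eval_iff_of_dvd_sub {R : Type*} [CommRing R] {k x y : R} (h : k ∣ x - y) (Q : R[X]) :
    k ∣ Q.eval x ↔ k ∣ Q.eval y :=
  dvd_iff_dvd_of_dvd_sub (h.trans (sub_dvd_eval_sub x y Q))

/-- The polynomial `F + t` over `ℤ[t]`. -/
noncomputable def genericTranslate (F : ℤ[X]) : ℤ[X][X] := F.map C + C X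

/-- For `f = F + t`, the polynomial `g ∘ f^(m+1)` over `ℤ[t]`, with its constant and linear terms
dropped, divided by `X ^ 2`. -/
noncomputable def genericCofactor (F g : ℤ[X]) (m : ℕ) : ℤ[X][X] :=
  (compIterate (genericTranslate F) (g.map C) (m + 1)).divX.divX

theorem map_compIterate_genericTranslate {k : Type*} [CommRing k] (F g : ℤ[X]) (τ : k) (m : ℕ) :
    (compIterate (genericTranslate F) (g.map C) m).map (aeval τ : ℤ[X] →ₐ[ℤ] k).toRingHom =
      compIterate (F.map (Int.castRingHom k) + C τ) (g.map (Int.castRingHom k)) m := by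
  have hC : (aeval τ : ℤ[X] →ₐ[ℤ] k).toRingHom.comp C = Int.castRingHom k := Subsingleton.elim _ _
  rw [map_compIterate, genericTranslate, Polynomial.map_add, Polynomial.map_map, Polynomial.map_map,
    map_C, hC]
  simp

namespace IsCriticalPair

variable {d : ℕ} {F g : ℤ[X]}

theorem monic_right (h : IsCriticalPair d F g) : g.Monic := by
  have hd : (d : ℤ) ≠ 0 := by have := h.two_le; lia
  refine mul_left_cancel₀ hd ?_
  have hlead := congrArg leadingCoeff h.derivative_eq
  rw [leadingCoeff_derivative, h.monic.leadingCoeff, h.natDegree_eq, leadingCoeff_mul,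
    leadingCoeff_C] at hlead
  exact hlead.symm.trans (mul_comm _ _)

theorem natDegree_right (h : IsCriticalPair d F g) : g.natDegree = d - 1 := by
  have hd : (d : ℤ) ≠ 0 := by have := h.two_le; lia
  rw [← natDegree_C_mul hd, ← h.derivative_eq, natDegree_derivative, h.natDegree_eq]

theorem coeff_one_ne_zero (h : IsCriticalPair d F g) : g.coeff 1 ≠ 0 := by
  have hsimple := h.separable.eval₂_derivative_ne_zero (RingHom.id ℂ) (x := 0)
    (by simpa [← coeff_zero_eq_eval_zero] using h.eval_zero_right)
  rw [← eval_map, Polynomial.map_id, ← coeff_zero_eq_eval_zero, coeff_derivative] at hsimple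
  simpa using hsimple

theorem monic_genericTranslate_and_natDegree (h : IsCriticalPair d F g) :
    (genericTranslate F).Monic ∧ (genericTranslate F).natDegree = d := by
  have hdeg : (F.map (C : ℤ →+* ℤ[X])).natDegree = d := by
    rw [h.monic.natDegree_map, h.natDegree_eq]
  have hlt : (C X : ℤ[X][X]).natDegree < (F.map (C : ℤ →+* ℤ[X])).natDegree := by
    have := h.two_le
    rw [hdeg, natDegree_C]
    lia
  exact ⟨(h.monic.map C).add_of_left (degree_lt_degree hlt), by
    rw [genericTranslate, natDegree_add_eq_left_of_natDegree_lt hlt, hdeg]⟩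

theorem monic_genericCofactor (h : IsCriticalPair d F g) (m : ℕ) :
    (genericCofactor F g m).Monic := by
  obtain ⟨hmonic, hdeg⟩ := h.monic_genericTranslate_and_natDegree
  have hd := h.two_le
  have hΓ := _root_.monic_compIterate hmonic (h.monic_right.map C) (by lia) (m + 1)
  have hΓdeg : 2 ≤ (compIterate (genericTranslate F) (g.map C) (m + 1)).natDegree := by
    rw [natDegree_compIterate, hdeg, h.monic_right.natDegree_map, h.natDegree_right, pow_succ']
    have hpow : 1 ≤ d ^ m := Nat.one_le_pow _ _ (by lia)
    calc 2 ≤ 1 * (d * 1) := by lia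
      _ ≤ (d - 1) * (d * d ^ m) := by gcongr; lia
  refine monic_divX (monic_divX hΓ (by lia)) ?_
  rw [natDegree_divX_eq_natDegree_tsub_one]
  lia

theorem compIterate_translate_eq {k : Type*} [CommRing k] (h : IsCriticalPair d F g) {m : ℕ}
    {τ : k} (hτ : aeval τ (critOrbit F (m + 1)) = 0) :
    compIterate (F.map (Int.castRingHom k) + C τ) (g.map (Int.castRingHom k)) (m + 1) =
      X ^ 2 * (genericCofactor F g m).map (aeval τ : ℤ[X] →ₐ[ℤ] k).toRingHom := by
  have hcoeff_zero : (compIterate (F.map (Int.castRingHom k) + C τ) (g.map (Int.castRingHom k))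
      (m + 1)).coeff 0 = 0 := by
    rw [coeff_zero_eq_eval_zero, eval_compIterate, ← aeval_critOrbit, hτ,
      ← coeff_zero_eq_eval_zero, coeff_map, coeff_zero_eq_eval_zero, h.eval_zero_right, map_zero]
  have hcoeff_one : (compIterate (genericTranslate F) (g.map C) (m + 1)).coeff 1 = 0 := by
    refine coeff_one_compIterate _ ?_ m
    rw [genericTranslate, derivative_add, derivative_C, add_zero, derivative_map, h.derivative_eq,
      ← coeff_zero_eq_eval_zero, coeff_map, coeff_C_mul, coeff_zero_eq_eval_zero, h.eval_zero_right,
      mul_zero, map_zero]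
  rw [← map_compIterate_genericTranslate, coeff_map] at hcoeff_zero
  rw [← map_compIterate_genericTranslate, eq_X_sq_mul_divX_divX hcoeff_one, Polynomial.map_add,
    map_C, hcoeff_zero, C_0, add_zero, Polynomial.map_mul, Polynomial.map_pow, map_X,
    genericCofactor]

theorem exists_isIntegral_parameter (h : IsCriticalPair d F g)
    (hescape : ∀ (t : ℂ) (m : ℕ), aeval t (critOrbit F (m + 1)) = 0 →
      OrbitsAvoidRoots (F.map (Int.castRingHom ℂ) + C t) (g.map (Int.castRingHom ℂ))) (m : ℕ) :
    ∃ t : ℂ, IsIntegral ℤ t ∧ aeval t (critOrbit F (m + 1)) = 0 ∧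
      aeval t (derivative (critOrbit F (m + 1))) ≠ 0 ∧
      aeval t ((genericCofactor F g m).coeff 0) ≠ 0 ∧
      aeval t ((genericCofactor F g m).resultant (derivative (genericCofactor F g m))) ≠ 0 := by
  obtain ⟨t, hper, hexact⟩ := h.exists_exact_period m
  have hd : (d : ℂ) ≠ 0 := by have := h.two_le; exact_mod_cast (by lia : d ≠ 0)
  have havoid := hescape t m hper
  have hder : derivative (F.map (Int.castRingHom ℂ) + C t) =
      C (d : ℂ) * g.map (Int.castRingHom ℂ) := by
    simp [derivative_map, h.derivative_eq]
  have hg : (g.map (Int.castRingHom ℂ)).eval 0 = 0 := by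
    simpa [← coeff_zero_eq_eval_zero] using h.eval_zero_right
  have hΨ := h.compIterate_translate_eq hper
  simp only [aeval_critOrbit] at hexact
  have hper' := aeval_critOrbit F (m + 1) t ▸ hper
  have hsep := havoid.separable_cofactor hder hd hg h.separable hper' hexact hΨ
  have hne := havoid.eval_zero_cofactor_ne_zero hder hd hg h.separable hper' hexact hΨ
  refine ⟨t, ⟨_, h.monic_critOrbit m, hper⟩, hper, ?_, ?_, ?_⟩
  · have hsimple := (h.separable_critOrbit m).eval₂_derivative_ne_zero (RingHom.id ℂ) (x := t)
      (by rwa [← eval_map, Polynomial.map_id, eval_map])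
    rwa [← eval_map, Polynomial.map_id, derivative_map, eval_map] at hsimple
  · rwa [← coeff_zero_eq_eval_zero, coeff_map] at hne
  · exact (separable_map_iff_resultant_ne_zero (h.monic_genericCofactor m) _).1 hsep

theorem swapAt_translate (h : IsCriticalPair d F g) {m p : ℕ} (hp : p.Prime) {t : ℤ}
    (hQ : (p : ℤ) ∣ (critOrbit F (m + 1)).eval t)
    (hQ_sq : ¬ (p : ℤ) ^ 2 ∣ (critOrbit F (m + 1)).eval t)
    (hΨ : ¬ (p : ℤ) ∣ ((genericCofactor F g m).coeff 0).eval t)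
    (hres : ¬ (p : ℤ) ∣
      ((genericCofactor F g m).resultant (derivative (genericCofactor F g m))).eval t)
    (hg : ¬ (p : ℤ) ∣ g.coeff 1) : SwapAt (compIterate (F + C t) g (m + 1)) p := by
  have : Fact p.Prime := ⟨hp⟩
  have haeval : ∀ Q : ℤ[X], aeval (t : ZMod p) Q = 0 ↔ (p : ℤ) ∣ Q.eval t := fun Q => by
    rw [← ZMod.intCast_zmod_eq_zero_iff_dvd, ← eq_intCast (algebraMap ℤ (ZMod p)) (Q.eval t),
      ← aeval_algebraMap_apply_eq_algebraMap_eval, eq_intCast]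
  refine ⟨(genericCofactor F g m).map (aeval (t : ZMod p) : ℤ[X] →ₐ[ℤ] ZMod p).toRingHom,
    ?_, ?_, ?_, ?_⟩
  · rw [← h.compIterate_translate_eq ((haeval _).2 hQ), map_compIterate, Polynomial.map_add, map_C,
      eq_intCast]
  · rw [separable_map_iff_resultant_ne_zero (h.monic_genericCofactor m)]
    exact (haeval _).not.2 hres
  · rw [← coeff_zero_eq_eval_zero, coeff_map]
    exact (haeval _).not.2 hΨ
  · have hdivX : ¬ (p : ℤ) ∣ g.divX.eval ((critOrbit F (m + 1)).eval t) := by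
      rwa [dvd_eval_iff_of_dvd_sub (y := 0) (by simpa using hQ), ← coeff_zero_eq_eval_zero,
        coeff_divX]
    have hval : (compIterate (F + C t) g (m + 1)).coeff 0 =
        g.divX.eval ((critOrbit F (m + 1)).eval t) * (critOrbit F (m + 1)).eval t := by
      rw [coeff_zero_eq_eval_zero, eval_compIterate, ← eval_critOrbit]
      conv_lhs => rw [← divX_mul_X_add g, coeff_zero_eq_eval_zero, h.eval_zero_right]
      simp
    rw [hval]
    exact fun hdvd =>
      hQ_sq ((Nat.prime_iff_prime_int.1 hp).pow_dvd_of_dvd_mul_left 2 hdivX hdvd)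

theorem exists_swapAt (h : IsCriticalPair d F g)
    (hescape : ∀ (t : ℂ) (m : ℕ), aeval t (critOrbit F (m + 1)) = 0 →
      OrbitsAvoidRoots (F.map (Int.castRingHom ℂ) + C t) (g.map (Int.castRingHom ℂ))) (m B : ℕ) :
    ∃ p : ℕ, B < p ∧ p.Prime ∧ ∃ t : ℤ, SwapAt (compIterate (F + C t) g (m + 1)) p := by
  obtain ⟨t₀, hint, hper, hQ', hΨ, hres⟩ := h.exists_isIntegral_parameter hescape m
  have hδ := mul_ne_zero (mul_ne_zero hres hΨ) hQ'
  rw [← map_mul, ← map_mul] at hδ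
  obtain ⟨p, hpB, hp, a, hQa, ha⟩ :=
    exists_prime_specialization hint hδ (max B (g.coeff 1).natAbs)
  have hpZ := Nat.prime_iff_prime_int.1 hp
  simp only [eval_mul, hpZ.dvd_mul, not_or] at ha
  obtain ⟨t, hta, htQ⟩ := exists_not_sq_dvd_eval hp ha.2
  have hg : ¬ (p : ℤ) ∣ g.coeff 1 := fun hdvd => hpB.not_ge <|
    (Nat.le_of_dvd (Int.natAbs_pos.2 h.coeff_one_ne_zero) (Int.natCast_dvd.1 hdvd)).trans
      (le_max_right _ _)
  have hmod := dvd_eval_iff_of_dvd_sub hta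
  exact ⟨p, (le_max_left _ _).trans_lt hpB, hp, t, h.swapAt_translate hp ((hmod _).2 (hQa _ hper))
    htQ ((hmod _).not.2 ha.1.2) ((hmod _).not.2 ha.1.1) hg⟩

end IsCriticalPair

end Transfer

section Escape

/-- A periodic critical point `0` forces the parameter `t` to be small, and then the other critical
points escape to the region of growth. -/
theorem orbitsAvoidRoots_of_escape {F g : ℂ[X]} {T : ℝ} (hT : 0 < T) (hF0 : F.eval 0 = 0)
    (hgrow : ∀ x t : ℂ, T ≤ ‖x‖ → ‖t‖ ≤ ‖x‖ → ‖x‖ ≤ ‖F.eval x + t‖)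
    (hcrit : ∀ α, α ≠ 0 → g.eval α = 0 → ‖α‖ < T ∧ 2 * T ≤ ‖F.eval α‖)
    {t : ℂ} {m : ℕ} (hper : (fun x => (F + C t).eval x)^[m + 1] 0 = 0) :
    OrbitsAvoidRoots (F + C t) g := by
  intro α hα hgα l
  set φ : ℂ → ℂ := fun x => (F + C t).eval x with hφ
  have hφx : ∀ x, φ x = F.eval x + t := fun x => by simp [hφ]
  have hiter : ∀ x, T ≤ ‖x‖ → ‖t‖ ≤ ‖x‖ → ∀ l, ‖x‖ ≤ ‖φ^[l] x‖ := by
    intro x hx ht l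
    induction l with
    | zero => simp
    | succ l ih =>
      rw [Function.iterate_succ_apply', hφx]
      exact ih.trans (hgrow _ t (hx.trans ih) (ht.trans ih))
  have ht : ‖t‖ < T := by
    by_contra! hTt
    have hescape := hiter t hTt le_rfl m
    rw [Function.iterate_succ_apply, hφx, hF0, zero_add] at hper
    rw [hper, norm_zero] at hescape
    linarith
  have hvalue : T ≤ ‖φ α‖ := by
    have hsub := norm_sub_le (φ α) t
    rw [hφx, add_sub_cancel_right, ← hφx] at hsub
    linarith [(hcrit α hα hgα).2]
  have horbit : T ≤ ‖φ^[l + 1] α‖ := hvalue.trans (hiter _ hvalue (ht.le.trans hvalue) l)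
  have hne : φ^[l + 1] α ≠ 0 := norm_pos_iff.1 (hT.trans_le horbit)
  exact fun hroot => horbit.not_gt (hcrit _ hne hroot).1

theorem exists_swapAt_quadratic (m B : ℕ) :
    ∃ p : ℕ, B < p ∧ p.Prime ∧ ∃ t : ℤ, SwapAt (compIterate (X ^ 2 + C t) X (m + 1)) p := by
  have h : IsCriticalPair 2 (X ^ 2) X :=
    ⟨le_rfl, monic_X_pow 2, natDegree_X_pow 2, by simp, by simpa using separable_X, by simp,
      by simp⟩
  exact h.exists_swapAt (fun t m _ α hα hgα => absurd (by simpa using hgα) hα) m B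

theorem isCriticalPair_trinomial {d : ℕ} (hd : 3 ≤ d) {b : ℤ} (hb : b ≠ 0) :
    IsCriticalPair d (X ^ d + C (d * b) * X ^ 2) (X ^ (d - 1) + C (2 * b) * X) := by
  obtain ⟨e, rfl⟩ : ∃ e, d = e + 3 := ⟨d - 3, by lia⟩
  have hlt : (C (((e + 3 : ℕ) : ℤ) * b) * X ^ 2 : ℤ[X]).degree < (X ^ (e + 3) : ℤ[X]).degree := by
    rw [degree_X_pow]
    exact (degree_C_mul_X_pow_le _ _).trans_lt (by exact_mod_cast (by lia : 2 < e + 3))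
  have hb0 : (-(2 * b) : ℂ) ≠ 0 := by simpa using hb
  have hmap : (X ^ (e + 2) + C (2 * b) * X : ℤ[X]).map (Int.castRingHom ℂ) =
      X * (X ^ (e + 1) - C (-(2 * b) : ℂ)) := by
    rw [Polynomial.map_add, Polynomial.map_mul, Polynomial.map_pow, map_X, map_C,
      eq_intCast (Int.castRingHom ℂ), Int.cast_mul, Int.cast_ofNat, C_neg]
    ring
  refine ⟨by lia, (monic_X_pow _).add_of_left hlt, ?_, ?_, ?_, by simp, by simp⟩
  · rw [natDegree_add_eq_left_of_degree_lt hlt, natDegree_X_pow]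
  · rw [derivative_add, derivative_X_pow, derivative_C_mul_X_pow, pow_one, C_mul, C_mul, C_mul]
    push_cast
    ring
  · have hcop : IsCoprime (X : ℂ[X]) (X ^ (e + 1) - C (-(2 * b) : ℂ)) :=
      (isCoprime_iff_aeval_ne_zero_of_isAlgClosed ℂ ℂ _ _).2 fun x => by
        by_cases hx : x = 0
        · simpa [hx] using hb
        · simp [hx]
    rw [show e + 3 - 1 = e + 2 by lia, hmap]
    exact separable_X.mul
      (separable_X_pow_sub_C _ (by exact_mod_cast Nat.succ_ne_zero e) hb0) hcop

theorem norm_le_norm_trinomial {d : ℕ} (hd : 3 ≤ d) {c x t : ℂ} (hx : ‖c‖ + 2 ≤ ‖x‖)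
    (ht : ‖t‖ ≤ ‖x‖) : ‖x‖ ≤ ‖x ^ d + c * x ^ 2 + t‖ := by
  have hx2 : 2 ≤ ‖x‖ := by linarith [norm_nonneg c]
  have htriangle : ‖x‖ ^ d ≤ ‖x ^ d + c * x ^ 2 + t‖ + (‖c‖ * ‖x‖ ^ 2 + ‖t‖) :=
    calc ‖x‖ ^ d = ‖(x ^ d + c * x ^ 2 + t) - (c * x ^ 2 + t)‖ := by
          rw [show (x ^ d + c * x ^ 2 + t) - (c * x ^ 2 + t) = x ^ d by ring, norm_pow]
      _ ≤ ‖x ^ d + c * x ^ 2 + t‖ + (‖c * x ^ 2‖ + ‖t‖) :=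
          (norm_sub_le _ _).trans (by gcongr; exact norm_add_le _ _)
      _ = _ := by rw [norm_mul, norm_pow]
  have hpow : (‖c‖ + 2) * ‖x‖ ^ 2 ≤ ‖x‖ ^ d :=
    calc (‖c‖ + 2) * ‖x‖ ^ 2 ≤ ‖x‖ * ‖x‖ ^ 2 := by gcongr
      _ = ‖x‖ ^ 3 := by ring
      _ ≤ ‖x‖ ^ d := pow_le_pow_right₀ (by linarith) hd
  nlinarith

/-- With `d = e + 3` and `b = 2 * 4 ^ e`, the point `α` is critical for `F = X ^ d + d b X ^ 2`, and
the second norm is that of `F(α)`. -/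
theorem norm_trinomial_of_critical (e : ℕ) {α : ℂ} (hα : α ≠ 0)
    (hroot : α ^ (e + 2) + 4 ^ (e + 1) * α = 0) :
    ‖α‖ = 4 ∧ ‖α ^ (e + 3) + (e + 3) * (2 * 4 ^ e) * α ^ 2‖ = (e + 1) * (2 * 4 ^ e) * 16 := by
  have hpow : α ^ (e + 1) = -4 ^ (e + 1) :=
    eq_neg_of_add_eq_zero_left (mul_left_cancel₀ hα (by linear_combination hroot))
  have hnorm : ‖α‖ = 4 := by
    have := congrArg norm hpow
    rw [norm_neg, norm_pow, norm_pow, Complex.norm_ofNat] at this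
    exact (pow_left_inj₀ (norm_nonneg _) (by norm_num) (Nat.succ_ne_zero e)).1 this
  have hvalue : α ^ (e + 3) + (e + 3) * (2 * 4 ^ e) * α ^ 2 =
      ((e + 1 : ℕ) : ℂ) * (2 * 4 ^ e) * α ^ 2 := by
    rw [pow_add _ (e + 1) 2, hpow]
    push_cast
    ring
  refine ⟨hnorm, ?_⟩
  rw [hvalue]
  simp only [norm_mul, norm_pow, hnorm, Complex.norm_natCast, Complex.norm_ofNat]
  push_cast
  ring

theorem exists_swapAt_trinomial {d : ℕ} (hd : 3 ≤ d) (m B : ℕ) :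
    ∃ b : ℤ, ∃ p : ℕ, B < p ∧ p.Prime ∧ ∃ t : ℤ,
      SwapAt (compIterate (X ^ d + C (d * b) * X ^ 2 + C t)
        (X ^ (d - 1) + C (2 * b) * X) (m + 1)) p := by
  obtain ⟨e, rfl⟩ : ∃ e, d = e + 3 := ⟨d - 3, by lia⟩
  refine ⟨2 * 4 ^ e, (isCriticalPair_trinomial hd (by positivity)).exists_swapAt ?_ m B⟩
  intro t m hper
  have hF (x : ℂ) : ((X ^ (e + 3) + C (((e + 3 : ℕ) : ℤ) * (2 * 4 ^ e)) * X ^ 2 : ℤ[X]).map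
      (Int.castRingHom ℂ)).eval x = x ^ (e + 3) + (e + 3) * (2 * 4 ^ e) * x ^ 2 := by
    simp
  have hg (x : ℂ) : ((X ^ (e + 3 - 1) + C (2 * (2 * 4 ^ e)) * X : ℤ[X]).map
      (Int.castRingHom ℂ)).eval x = x ^ (e + 2) + 2 * (2 * 4 ^ e) * x := by
    simp
  have hc : ‖((e + 3) * (2 * 4 ^ e) : ℂ)‖ = (e + 3) * (2 * 4 ^ e) := by
    exact_mod_cast Complex.norm_natCast ((e + 3) * (2 * 4 ^ e))
  have hb : (1 : ℝ) ≤ 4 ^ e := one_le_pow₀ (by norm_num)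
  have he : (0 : ℝ) ≤ e := Nat.cast_nonneg e
  refine orbitsAvoidRoots_of_escape (T := (e + 3) * (2 * 4 ^ e) + 2) (by positivity)
    (by simp) (fun x t hx ht => ?_) (fun α hα hgα => ?_) (aeval_critOrbit _ (m + 1) t ▸ hper)
  · rw [hF]
    exact norm_le_norm_trinomial hd (hc.symm ▸ hx) ht
  · obtain ⟨hnorm, hvalue⟩ := norm_trinomial_of_critical e hα (by linear_combination hgα - hg α)
    rw [hF, hnorm, hvalue]
    constructor <;> nlinarith [hb, he]

end Escape

section Congruence

theorem C_dvd_sub_iff_map_eq {N : ℕ} {a b : ℤ[X]} :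
    C (N : ℤ) ∣ a - b ↔
      a.map (Int.castRingHom (ZMod N)) = b.map (Int.castRingHom (ZMod N)) := by
  rw [C_dvd_iff_dvd_coeff, Polynomial.ext_iff]
  refine forall_congr' fun i => ?_
  rw [coeff_map, coeff_map, eq_intCast, eq_intCast, eq_comm, ZMod.intCast_eq_intCast_iff_dvd_sub,
    coeff_sub]

theorem map_eq_map_of_sq_dvd {p : ℕ} {a b : ℤ[X]} (h : C ((p : ℤ) ^ 2) ∣ a - b) :
    a.map (Int.castRingHom (ZMod p)) = b.map (Int.castRingHom (ZMod p)) :=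
  C_dvd_sub_iff_map_eq.1 (dvd_trans (C_pow (R := ℤ) ▸ dvd_pow_self _ two_ne_zero) h)

theorem dvd_coeff_iff_of_C_dvd_sub {R : Type*} [CommRing R] {k : R} {a b : R[X]}
    (h : C k ∣ a - b) (i : ℕ) : k ∣ a.coeff i ↔ k ∣ b.coeff i :=
  dvd_iff_dvd_of_dvd_sub (by simpa using (C_dvd_iff_dvd_coeff _ _).1 h i)

theorem C_dvd_compIterate_sub {N : ℕ} {f g f' g' : ℤ[X]} (hf : C (N : ℤ) ∣ f' - f)
    (hg : C (N : ℤ) ∣ g' - g) (m : ℕ) : C (N : ℤ) ∣ compIterate f' g' m - compIterate f g m := by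
  rw [C_dvd_sub_iff_map_eq] at *
  rw [map_compIterate, map_compIterate, hf, hg]

theorem TransitiveAt.congr {d q : ℕ} {f g f' g' : ℤ[X]} (h : TransitiveAt d f g q)
    (hf : C ((q : ℤ) ^ 2) ∣ f' - f) (hg : C ((q : ℤ) ^ 2) ∣ g' - g) : TransitiveAt d f' g' q where
  map_left := (map_eq_map_of_sq_dvd hf).trans h.map_left
  map_right := (map_eq_map_of_sq_dvd hg).trans h.map_right
  sq_dvd_left := (dvd_coeff_iff_of_C_dvd_sub hf 0).2 h.sq_dvd_left
  not_sq_dvd_right := mt (dvd_coeff_iff_of_C_dvd_sub hg 0).1 h.not_sq_dvd_right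

theorem DoublyTransitiveAt.congr {d r : ℕ} {f g f' g' : ℤ[X]} (h : DoublyTransitiveAt d f g r)
    (hf : C ((r : ℤ) ^ 2) ∣ f' - f) (hg : C ((r : ℤ) ^ 2) ∣ g' - g) :
    DoublyTransitiveAt d f' g' r where
  map_left := (map_eq_map_of_sq_dvd hf).trans h.map_left
  map_right := (map_eq_map_of_sq_dvd hg).trans h.map_right
  left_ne_zero := h.left_ne_zero
  right_ne_zero := h.right_ne_zero
  sq_dvd_left := (dvd_coeff_iff_of_C_dvd_sub hf 0).2 h.sq_dvd_left
  not_sq_dvd_right := mt (dvd_coeff_iff_of_C_dvd_sub hg 0).1 h.not_sq_dvd_right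

theorem SwapAt.congr {p : ℕ} {h h' : ℤ[X]} (hh : SwapAt h p)
    (hdvd : C ((p : ℤ) ^ 2) ∣ h' - h) : SwapAt h' p := by
  obtain ⟨Ψ, hmap, hsep, hΨ, hcoeff⟩ := hh
  exact ⟨Ψ, (map_eq_map_of_sq_dvd hdvd).trans hmap, hsep, hΨ,
    mt (dvd_coeff_iff_of_C_dvd_sub hdvd 0).1 hcoeff⟩

theorem exists_degree_lt_C_dvd_sub {R : Type*} [CommRing R] {d : ℕ} {a b : R}
    (hab : IsCoprime a b) {h₁ h₂ : R[X]} (hd₁ : h₁.degree < d) (hd₂ : h₂.degree < d) :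
    ∃ h : R[X], h.degree < d ∧ C a ∣ h - h₁ ∧ C b ∣ h - h₂ := by
  obtain ⟨u, v, huv⟩ := hab
  have hC : C u * C a + C v * C b = 1 := by rw [← C_mul, ← C_mul, ← C_add, huv, C_1]
  refine ⟨(u * a) • h₂ + (v * b) • h₁, ?_, ⟨C u * (h₂ - h₁), ?_⟩, ⟨C v * (h₁ - h₂), ?_⟩⟩
  · exact (degree_add_le _ _).trans_lt
      (max_lt ((degree_smul_le _ _).trans_lt hd₂) ((degree_smul_le _ _).trans_lt hd₁))
  · rw [smul_eq_C_mul, smul_eq_C_mul, C_mul, C_mul]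
    linear_combination h₁ * hC
  · rw [smul_eq_C_mul, smul_eq_C_mul, C_mul, C_mul]
    linear_combination h₂ * hC

/-- A property of polynomials which holds on the residue class of a polynomial of degree less
than `d` modulo some positive integer, where the prime factors of the modulus can be chosen
arbitrarily large; the last clause makes finitely many such properties compatible. -/
def HoldsOnResidueClass (d : ℕ) (P : ℤ[X] → Prop) : Prop :=
  ∀ B : ℕ, ∃ N : ℕ, N ≠ 0 ∧ (∀ p : ℕ, p.Prime → p ∣ N → B < p) ∧
    ∃ h₀ : ℤ[X], h₀.degree < d ∧ ∀ h : ℤ[X], C (N : ℤ) ∣ h - h₀ → P h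

theorem HoldsOnResidueClass.and {d : ℕ} {P Q : ℤ[X] → Prop} (hP : HoldsOnResidueClass d P)
    (hQ : HoldsOnResidueClass d Q) : HoldsOnResidueClass d fun h => P h ∧ Q h := by
  intro B
  obtain ⟨N, hN, hNB, h₁, hd₁, hP⟩ := hP B
  obtain ⟨M, hM, hMB, h₂, hd₂, hQ⟩ := hQ (max B N)
  have hcop : N.Coprime M := Nat.coprime_of_dvd fun p hp hpN hpM =>
    ((le_max_right _ _).trans_lt (hMB p hp hpM)).not_ge
      (Nat.le_of_dvd (Nat.pos_of_ne_zero hN) hpN)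
  obtain ⟨h₀, hd₀, hN₀, hM₀⟩ := exists_degree_lt_C_dvd_sub hcop.isCoprime hd₁ hd₂
  refine ⟨N * M, mul_ne_zero hN hM, fun p hp hpd => ?_, h₀, hd₀, fun h hh => ?_⟩
  · exact (hp.dvd_mul.1 hpd).elim (hNB p hp) fun hpM =>
      (le_max_left _ _).trans_lt (hMB p hp hpM)
  · rw [Nat.cast_mul, C_mul] at hh
    refine ⟨hP h ?_, hQ h ?_⟩
    · simpa using dvd_add ((dvd_mul_right _ _).trans hh) hN₀
    · simpa using dvd_add ((dvd_mul_left _ _).trans hh) hM₀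

theorem HoldsOnResidueClass.mono {d : ℕ} {P Q : ℤ[X] → Prop} (hP : HoldsOnResidueClass d P)
    (hPQ : ∀ h, P h → Q h) : HoldsOnResidueClass d Q := fun B => by
  obtain ⟨N, hN, hNB, h₀, hd₀, hP⟩ := hP B
  exact ⟨N, hN, hNB, h₀, hd₀, fun h hh => hPQ h (hP h hh)⟩

theorem holdsOnResidueClass_of_forall {d : ℕ} {P : ℤ[X] → Prop} (hP : ∀ h, P h) :
    HoldsOnResidueClass d P := fun _ =>
  ⟨1, one_ne_zero, fun _ hp hp1 => absurd (Nat.dvd_one.1 hp1) hp.ne_one, 0,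
    degree_zero (R := ℤ) ▸ WithBot.bot_lt_coe _, fun h _ => hP h⟩

theorem HoldsOnResidueClass.imp {d : ℕ} {Q : Prop} {P : ℤ[X] → Prop}
    (hP : Q → HoldsOnResidueClass d P) : HoldsOnResidueClass d fun h => Q → P h := by
  by_cases hQ : Q
  · exact (hP hQ).mono fun h hh _ => hh
  · exact holdsOnResidueClass_of_forall fun h hh => absurd hh hQ

theorem HoldsOnResidueClass.forall_le {d : ℕ} {P : ℕ → ℤ[X] → Prop}
    (hP : ∀ m, HoldsOnResidueClass d (P m)) (n : ℕ) :
    HoldsOnResidueClass d fun h => ∀ m ≤ n, P m h := by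
  induction n with
  | zero => simpa using hP 0
  | succ n ih =>
    simpa only [Nat.le_succ_iff_eq_or_le, forall_eq_or_imp] using (hP (n + 1)).and ih

theorem holdsOnResidueClass_of_prime {d : ℕ} {P : ℕ → ℤ[X] → Prop}
    (hcongr : ∀ (p : ℕ) (h h' : ℤ[X]), C ((p : ℤ) ^ 2) ∣ h' - h → P p h → P p h')
    (hex : ∀ B : ℕ, ∃ p : ℕ, B < p ∧ p.Prime ∧ ∃ h : ℤ[X], h.degree < d ∧ P p h)
    {D : ℤ} (hD : D ≠ 0) :
    HoldsOnResidueClass d fun h => ∃ p : ℕ, p.Prime ∧ ¬ (p : ℤ) ∣ D ∧ P p h := by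
  intro B
  obtain ⟨p, hpB, hp, h₀, hd₀, hP₀⟩ := hex (max B D.natAbs)
  refine ⟨p ^ 2, pow_ne_zero _ hp.ne_zero, fun q hq hqp => ?_, h₀, hd₀, fun h hh => ⟨p, hp, ?_,
    hcongr p h₀ h (by exact_mod_cast hh) hP₀⟩⟩
  · rw [(Nat.prime_dvd_prime_iff_eq hq hp).1 (hq.dvd_of_dvd_pow hqp)]
    exact (le_max_left _ _).trans_lt hpB
  · exact fun hpD => ((le_max_right _ _).trans_lt hpB).not_ge
      (Nat.le_of_dvd (Int.natAbs_pos.2 hD) (Int.natCast_dvd.1 hpD))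

end Congruence

section Family

/-- The polynomial `h(0) + d (h - h(0))`: all coefficients of `h` but the constant one are
multiplied by `d`. -/
noncomputable def lowerPart (d : ℕ) (h : ℤ[X]) : ℤ[X] :=
  C (h.coeff 0) + C (d : ℤ) * (h - C (h.coeff 0))

/-- The member of the family of polynomials of degree `d` with derivative divisible by `d` which
has parameter `h`, a polynomial of degree less than `d`. -/
noncomputable def familyPoly (d : ℕ) (h : ℤ[X]) : ℤ[X] := X ^ d + lowerPart d h

/-- The derivative of `familyPoly d h`, divided by `d`. -/
noncomputable def familyDeriv (d : ℕ) (h : ℤ[X]) : ℤ[X] := X ^ (d - 1) + derivative h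

theorem coeff_lowerPart (d : ℕ) (h : ℤ[X]) (i : ℕ) :
    (lowerPart d h).coeff i = (if i = 0 then 1 else (d : ℤ)) * h.coeff i := by
  rcases eq_or_ne i 0 with rfl | hi
  · simp [lowerPart]
  · rw [lowerPart, coeff_add, coeff_C_mul, coeff_sub, coeff_C_of_ne_zero hi, if_neg hi, zero_add,
      sub_zero]

theorem degree_lowerPart_lt {d : ℕ} {h : ℤ[X]} (hh : h.degree < d) :
    (lowerPart d h).degree < d := by
  rw [degree_lt_iff_coeff_zero] at hh ⊢
  exact fun i hi => by rw [coeff_lowerPart, hh i hi, mul_zero]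

theorem derivative_familyPoly (d : ℕ) (h : ℤ[X]) :
    derivative (familyPoly d h) = C (d : ℤ) * familyDeriv d h := by
  rw [familyPoly, lowerPart, familyDeriv, derivative_add, derivative_X_pow, derivative_add,
    derivative_C, derivative_C_mul, derivative_sub, derivative_C, C_eq_natCast]
  ring

theorem isMonicPair_family {d : ℕ} (hd : 2 ≤ d) {h : ℤ[X]} (hh : h.degree < d) :
    IsMonicPair d (familyPoly d h) (familyDeriv d h) := by
  have hlower : (lowerPart d h).degree < (X ^ d : ℤ[X]).degree := by
    rw [degree_X_pow]
    exact degree_lowerPart_lt hh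
  have hderiv : (derivative h).degree < (X ^ (d - 1) : ℤ[X]).degree := by
    rw [degree_X_pow]
    rw [degree_lt_iff_coeff_zero] at hh ⊢
    exact fun i hi => by rw [coeff_derivative, hh (i + 1) (by lia), zero_mul]
  exact ⟨hd, (monic_X_pow d).add_of_left hlower, (monic_X_pow _).add_of_left hderiv,
    by rw [familyPoly, natDegree_add_eq_left_of_degree_lt hlower, natDegree_X_pow],
    by rw [familyDeriv, natDegree_add_eq_left_of_degree_lt hderiv, natDegree_X_pow]⟩

theorem C_dvd_familyPoly_sub {k : ℤ} {h h' : ℤ[X]} (hk : C k ∣ h' - h) (d : ℕ) :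
    C k ∣ familyPoly d h' - familyPoly d h := by
  rw [familyPoly, familyPoly, add_sub_add_left_eq_sub, C_dvd_iff_dvd_coeff]
  intro i
  rw [coeff_sub, coeff_lowerPart, coeff_lowerPart, ← mul_sub, ← coeff_sub]
  exact ((C_dvd_iff_dvd_coeff _ _).1 hk i).mul_left _

theorem C_dvd_familyDeriv_sub {k : ℤ} {h h' : ℤ[X]} (hk : C k ∣ h' - h) (d : ℕ) :
    C k ∣ familyDeriv d h' - familyDeriv d h := by
  obtain ⟨w, hw⟩ := hk
  rw [familyDeriv, familyDeriv, add_sub_add_left_eq_sub, ← derivative_sub, hw, derivative_C_mul]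
  exact dvd_mul_right _ _

end Family

section Examples

theorem map_C_natCast_self (N : ℕ) : (C (N : ℤ)).map (Int.castRingHom (ZMod N)) = 0 := by
  rw [map_C, eq_intCast, Int.cast_natCast, CharP.cast_eq_zero, C_0]

theorem not_sq_dvd_self_of_prime {p : ℕ} (hp : p.Prime) : ¬ (p : ℤ) ^ 2 ∣ p := by
  have hp' := Nat.prime_iff_prime_int.1 hp
  rw [pow_two]
  exact fun h => hp'.not_isUnit (hp'.squarefree _ h)

theorem natCast_zmod_ne_zero {a N : ℕ} (ha : a ≠ 0) (haN : a < N) : (a : ZMod N) ≠ 0 := by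
  rw [Ne, ZMod.natCast_eq_zero_iff]
  exact Nat.not_dvd_of_pos_of_lt (Nat.pos_of_ne_zero ha) haN

theorem familyPoly_of_coeff_zero (d : ℕ) {h : ℤ[X]} (h0 : h.coeff 0 = 0) :
    familyPoly d h = X ^ d + C (d : ℤ) * h := by
  rw [familyPoly, lowerPart, h0, C_0, zero_add, sub_zero]

theorem transitiveAt_family {d : ℕ} (hd : 2 ≤ d) {q : ℕ} (hq : q.Prime) :
    TransitiveAt d (familyPoly d (C (q : ℤ) * X)) (familyDeriv d (C (q : ℤ) * X)) q := by
  have hf : familyPoly d (C (q : ℤ) * X) = X ^ d + C (q : ℤ) * (C (d : ℤ) * X) := by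
    rw [familyPoly_of_coeff_zero d (by simp)]
    ring
  have hg : familyDeriv d (C (q : ℤ) * X) = X ^ (d - 1) + C (q : ℤ) := by
    rw [familyDeriv, derivative_C_mul, derivative_X, mul_one]
  constructor
  · simp only [hf, Polynomial.map_add, Polynomial.map_mul, map_C_natCast_self, zero_mul, add_zero,
      Polynomial.map_pow, map_X]
  · simp only [hg, Polynomial.map_add, map_C_natCast_self, add_zero, Polynomial.map_pow, map_X]
  · rw [hf]
    simp [coeff_X_pow, show (0 : ℕ) ≠ d by lia]
  · rw [hg, coeff_add, coeff_X_pow, if_neg (by lia), zero_add, coeff_C_zero]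
    exact not_sq_dvd_self_of_prime hq

theorem doublyTransitiveAt_family {d : ℕ} (hd : 3 ≤ d) {r : ℕ} (hr : r.Prime) (hdr : d < r) :
    DoublyTransitiveAt d (familyPoly d (C (r : ℤ) * X - X ^ (d - 1)))
      (familyDeriv d (C (r : ℤ) * X - X ^ (d - 1))) r := by
  obtain ⟨e, rfl⟩ : ∃ e, d = e + 3 := ⟨d - 3, by lia⟩
  have hd1 : (((e + 3 : ℕ) : ZMod r) - 1) = ((e + 2 : ℕ) : ZMod r) := by
    push_cast
    ring
  have hf : familyPoly (e + 3) (C (r : ℤ) * X - X ^ (e + 2)) =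
      X ^ (e + 2) * (X - C ((e + 3 : ℕ) : ℤ)) + C (r : ℤ) * (C ((e + 3 : ℕ) : ℤ) * X) := by
    rw [familyPoly_of_coeff_zero _ (by simp)]
    ring
  have hg : familyDeriv (e + 3) (C (r : ℤ) * X - X ^ (e + 2)) =
      X ^ (e + 1) * (X - C ((e + 2 : ℕ) : ℤ)) + C (r : ℤ) := by
    rw [familyDeriv, derivative_sub, derivative_C_mul, derivative_X, derivative_X_pow,
      show e + 3 - 1 = e + 2 by lia, show e + 2 - 1 = e + 1 by lia, C_eq_natCast, C_eq_natCast]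
    ring
  have hfcoeff : (familyPoly (e + 3) (C (r : ℤ) * X - X ^ (e + 2))).coeff 0 = 0 := by
    rw [hf]
    simp
  have hgcoeff : (familyDeriv (e + 3) (C (r : ℤ) * X - X ^ (e + 2))).coeff 0 = r := by
    rw [hg, coeff_add, coeff_C_zero, mul_coeff_zero, coeff_X_pow, if_neg (by lia), zero_mul,
      zero_add]
  rw [show e + 3 - 1 = e + 2 by lia]
  refine ⟨?_, ?_, natCast_zmod_ne_zero (by lia) hdr, ?_, ?_, ?_⟩
  · rw [hf, show e + 3 - 1 = e + 2 by lia, Polynomial.map_add, Polynomial.map_mul,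
      Polynomial.map_mul, map_C_natCast_self, zero_mul, add_zero, Polynomial.map_pow,
      Polynomial.map_sub, map_X, map_C, eq_intCast, Int.cast_natCast]
  · rw [hg, hd1, show e + 3 - 2 = e + 1 by lia, Polynomial.map_add, Polynomial.map_mul,
      map_C_natCast_self, add_zero, Polynomial.map_pow, Polynomial.map_sub, map_X, map_C,
      eq_intCast, Int.cast_natCast]
  · rw [hd1]
    exact natCast_zmod_ne_zero (by lia) (by lia)
  · rw [hfcoeff]
    exact dvd_zero _
  · rw [hgcoeff]
    exact not_sq_dvd_self_of_prime hr

theorem holdsOnResidueClass_transitiveAt {d : ℕ} (hd : 2 ≤ d) {D : ℤ} (hD : D ≠ 0) :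
    HoldsOnResidueClass d fun h => ∃ q : ℕ, q.Prime ∧ ¬ (q : ℤ) ∣ D ∧
      TransitiveAt d (familyPoly d h) (familyDeriv d h) q := by
  refine holdsOnResidueClass_of_prime
    (fun p h h' hh hp => hp.congr (C_dvd_familyPoly_sub hh d) (C_dvd_familyDeriv_sub hh d))
    (fun B => ?_) hD
  obtain ⟨q, hqB, hq⟩ := Nat.exists_infinite_primes (B + 1)
  exact ⟨q, hqB, hq, C (q : ℤ) * X, (degree_C_mul_X_le _).trans_lt (by exact_mod_cast hd),
    transitiveAt_family hd hq⟩

theorem holdsOnResidueClass_doublyTransitiveAt {d : ℕ} (hd : 3 ≤ d) {D : ℤ} (hD : D ≠ 0) :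
    HoldsOnResidueClass d fun h => ∃ r : ℕ, r.Prime ∧ ¬ (r : ℤ) ∣ D ∧
      DoublyTransitiveAt d (familyPoly d h) (familyDeriv d h) r := by
  refine holdsOnResidueClass_of_prime
    (fun p h h' hh hp => hp.congr (C_dvd_familyPoly_sub hh d) (C_dvd_familyDeriv_sub hh d))
    (fun B => ?_) hD
  obtain ⟨r, hrB, hr⟩ := Nat.exists_infinite_primes (max B d + 1)
  refine ⟨r, (le_max_left _ _).trans_lt hrB, hr, C (r : ℤ) * X - X ^ (d - 1), ?_,
    doublyTransitiveAt_family hd hr ((le_max_right _ _).trans_lt hrB)⟩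
  refine (degree_sub_le _ _).trans_lt (max_lt ((degree_C_mul_X_le _).trans_lt ?_) ?_)
  · exact_mod_cast (by lia : 1 < d)
  · rw [degree_X_pow]
    exact_mod_cast (by lia : d - 1 < d)

theorem swapAt_familyDeriv_three {p : ℕ} (hp : p.Prime) :
    SwapAt (familyDeriv 3 (C (p : ℤ) * X)) p := by
  have := Fact.mk hp
  have hg : familyDeriv 3 (C (p : ℤ) * X) = X ^ 2 + C (p : ℤ) := by
    rw [familyDeriv, derivative_C_mul, derivative_X, mul_one]
  refine ⟨1, ?_, separable_one, by simp, ?_⟩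
  · rw [hg, Polynomial.map_add, map_C_natCast_self, add_zero, Polynomial.map_pow, map_X, mul_one]
  · rw [hg]
    simpa [coeff_X_pow] using not_sq_dvd_self_of_prime hp

theorem swapAt_familyDeriv {d : ℕ} (hd : 4 ≤ d) {p : ℕ} (hp : p.Prime) (hdp : d ≤ p) :
    SwapAt (familyDeriv d (X ^ 3 + C (p : ℤ) * X)) p := by
  have := Fact.mk hp
  obtain ⟨e, rfl⟩ : ∃ e, d = e + 4 := ⟨d - 4, by lia⟩
  have hg : familyDeriv (e + 4) (X ^ 3 + C (p : ℤ) * X) =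
      X ^ 2 * (X ^ (e + 1) - C (-3)) + C (p : ℤ) := by
    rw [familyDeriv, derivative_add, derivative_C_mul, derivative_X, derivative_X_pow,
      show e + 4 - 1 = e + 3 by lia, C_neg, Nat.cast_ofNat]
    ring
  have h3 : (3 : ZMod p) ≠ 0 := by
    exact_mod_cast natCast_zmod_ne_zero (N := p) three_ne_zero (by lia)
  refine ⟨X ^ (e + 1) - C (-3), ?_, ?_, by simpa using h3, ?_⟩
  · rw [hg, Polynomial.map_add, map_C_natCast_self, add_zero, Polynomial.map_mul,
      Polynomial.map_sub, Polynomial.map_pow, Polynomial.map_pow, map_X, map_C, map_neg, map_ofNat]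
  · exact separable_X_pow_sub_C _ (natCast_zmod_ne_zero (by lia) (by lia)) (neg_ne_zero.2 h3)
  · rw [hg]
    simpa [coeff_X_pow] using not_sq_dvd_self_of_prime hp

theorem exists_swapAt_familyDeriv {d : ℕ} (hd : 3 ≤ d) (B : ℕ) :
    ∃ p : ℕ, B < p ∧ p.Prime ∧ ∃ h : ℤ[X], h.degree < d ∧ SwapAt (familyDeriv d h) p := by
  obtain ⟨p, hpB, hp⟩ := Nat.exists_infinite_primes (max B d + 1)
  have hlinear : (C (p : ℤ) * X).degree < (d : WithBot ℕ) :=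
    (degree_C_mul_X_le _).trans_lt (by exact_mod_cast (by lia : 1 < d))
  refine ⟨p, (le_max_left _ _).trans_lt hpB, hp, ?_⟩
  obtain rfl | hd4 := hd.eq_or_lt
  · exact ⟨_, hlinear, swapAt_familyDeriv_three hp⟩
  · refine ⟨_, (degree_add_le _ _).trans_lt (max_lt ?_ hlinear),
      swapAt_familyDeriv hd4 hp ((le_max_right _ _).trans_lt hpB).le⟩
    rw [degree_X_pow]
    exact_mod_cast hd4

theorem exists_swapAt_compIterate_family {d : ℕ} (hd : 2 ≤ d) (m B : ℕ) :
    ∃ p : ℕ, B < p ∧ p.Prime ∧ ∃ h : ℤ[X], h.degree < d ∧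
      SwapAt (compIterate (familyPoly d h) (familyDeriv d h) (m + 1)) p := by
  obtain rfl | hd3 := hd.eq_or_lt
  · obtain ⟨p, hpB, hp, t, ht⟩ := exists_swapAt_quadratic m B
    refine ⟨p, hpB, hp, C t, degree_C_le.trans_lt (by norm_num), ?_⟩
    have hf : familyPoly 2 (C t) = X ^ 2 + C t := by
      rw [familyPoly, lowerPart, coeff_C_zero, sub_self, mul_zero, add_zero]
    have hg : familyDeriv 2 (C t) = X := by
      rw [familyDeriv, derivative_C, add_zero, pow_one]
    rwa [hf, hg]
  · obtain ⟨b, p, hpB, hp, t, ht⟩ := exists_swapAt_trinomial hd3 m B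
    refine ⟨p, hpB, hp, C b * X ^ 2 + C t, ?_, ?_⟩
    · exact (degree_add_le _ _).trans_lt (max_lt
        ((degree_C_mul_X_pow_le _ _).trans_lt (by exact_mod_cast hd3))
        (degree_C_le.trans_lt (by exact_mod_cast (by lia : 0 < d))))
    have hf : familyPoly d (C b * X ^ 2 + C t) = X ^ d + C (d * b) * X ^ 2 + C t := by
      have h0 : (C b * X ^ 2 + C t : ℤ[X]).coeff 0 = t := by simp
      rw [familyPoly, lowerPart, h0, C_mul]
      ring
    have hg : familyDeriv d (C b * X ^ 2 + C t) = X ^ (d - 1) + C (2 * b) * X := by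
      rw [familyDeriv, derivative_add, derivative_C, derivative_C_mul_X_pow, add_zero, pow_one,
        Nat.cast_ofNat, mul_comm b]
    rwa [hf, hg]

theorem holdsOnResidueClass_swapAt {d : ℕ} (hd : 2 ≤ d) {D : ℤ} (hD : D ≠ 0) {m : ℕ}
    (hm : m = 0 → 3 ≤ d) :
    HoldsOnResidueClass d fun h => ∃ p : ℕ, p.Prime ∧ ¬ (p : ℤ) ∣ D ∧
      SwapAt (compIterate (familyPoly d h) (familyDeriv d h) m) p := by
  refine holdsOnResidueClass_of_prime (P := fun p h =>
    SwapAt (compIterate (familyPoly d h) (familyDeriv d h) m) p)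
    (fun p h h' hh hp => hp.congr ?_) (fun B => ?_) hD
  · rw [← Nat.cast_pow] at hh ⊢
    exact C_dvd_compIterate_sub (C_dvd_familyPoly_sub hh d) (C_dvd_familyDeriv_sub hh d) m
  · cases m with
    | zero => simpa only [compIterate_zero] using exists_swapAt_familyDeriv (hm rfl) B
    | succ m => exact exists_swapAt_compIterate_family hd m B

theorem holdsOnResidueClass_hasWitnessPrimes {d : ℕ} (hd : 2 ≤ d) {D : ℤ} (hD : D ≠ 0) (n : ℕ) :
    HoldsOnResidueClass d fun h => HasWitnessPrimes D d n (familyPoly d h) (familyDeriv d h) :=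
  ((holdsOnResidueClass_transitiveAt hd hD).and
    ((HoldsOnResidueClass.imp fun h3 => holdsOnResidueClass_doublyTransitiveAt h3 hD).and
      (HoldsOnResidueClass.forall_le
        (fun _ => HoldsOnResidueClass.imp fun hm => holdsOnResidueClass_swapAt hd hD hm) n))).mono
    fun _ ⟨htrans, hdouble, hswap⟩ => ⟨htrans, hdouble, hswap⟩

end Examples

section ZariskiDensity

theorem zariskiDense_pi {K ι : Type*} [Field K] [Finite ι] {s : ι → Set K}
    (hs : ∀ i, (s i).Infinite) : ZariskiDense (Set.univ.pi s) := by
  intro P hP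
  by_contra! hvanish
  exact hP (MvPolynomial.funext_set s hs fun x hx => by rw [hvanish x hx, map_zero])

theorem ZariskiDense.mono {K ι : Type*} [Field K] {S T : Set (ι → K)} (hS : ZariskiDense S)
    (hST : S ⊆ T) : ZariskiDense T := fun P hP =>
  (hS P hP).imp fun _ hx => ⟨hST hx.1, hx.2⟩

theorem infinite_intCast_mul_residueClass (K : Type*) [Ring K] [CharZero K] {u N : ℤ} (hu : u ≠ 0)
    (hN : N ≠ 0) (b₀ : ℤ) : {x : K | ∃ b : ℤ, N ∣ b - b₀ ∧ x = (u * b : ℤ)}.Infinite :=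
  Set.infinite_of_injective_forall_mem (f := fun k : ℤ => ((u * (b₀ + N * k) : ℤ) : K))
    (fun _ _ hkl => mul_left_cancel₀ hN (add_left_cancel
      (mul_left_cancel₀ hu (Int.cast_injective (α := K) hkl))))
    fun _ => ⟨_, by simp, rfl⟩

theorem zariskiDense_lowerPart {K : Type*} [Field K] [CharZero K] {d : ℕ} (hd : d ≠ 0) {N : ℕ}
    (hN : N ≠ 0) {h₀ : ℤ[X]} (hd₀ : h₀.degree < d) :
    ZariskiDense {c : Fin d → K | ∃ h : ℤ[X], h.degree < d ∧ C (N : ℤ) ∣ h - h₀ ∧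
      c = fun i : Fin d => ((lowerPart d h).coeff i : K)} := by
  have hu (i : Fin d) : (if (i : ℕ) = 0 then 1 else (d : ℤ)) ≠ 0 := by
    split_ifs
    exacts [one_ne_zero, by exact_mod_cast hd]
  refine (zariskiDense_pi fun i : Fin d => infinite_intCast_mul_residueClass K (hu i)
    (by exact_mod_cast hN : (N : ℤ) ≠ 0) (h₀.coeff i)).mono fun c hc => ?_
  choose b hb hcb using fun i => hc i (Set.mem_univ i)
  obtain ⟨⟨h, hmem⟩, hcoeff⟩ := (degreeLTEquiv ℤ d).surjective b
  have hh : h.degree < d := mem_degreeLT.1 hmem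
  replace hcoeff (i : Fin d) : h.coeff i = b i := congrFun hcoeff i
  refine ⟨h, hh, (C_dvd_iff_dvd_coeff _ _).2 fun i => ?_, funext fun i => ?_⟩
  · rcases lt_or_ge i d with hi | hi
    · rw [coeff_sub, hcoeff ⟨i, hi⟩]
      exact hb ⟨i, hi⟩
    · rw [coeff_sub, (degree_lt_iff_coeff_zero _ _).1 hh i hi,
        (degree_lt_iff_coeff_zero _ _).1 hd₀ i hi, sub_zero]
      exact dvd_zero _
  · rw [hcb, coeff_lowerPart, hcoeff]

end ZariskiDensity

theorem monicOfCoeffs_lowerPart {K : Type*} [Field K] {d : ℕ} {h : ℤ[X]} (hh : h.degree < d) :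
    monicOfCoeffs (fun i : Fin d => ((lowerPart d h).coeff i : K)) =
      (familyPoly d h).map (Int.castRingHom K) := by
  have hsum := sum_fin (fun i c => C c * X ^ i) (by simp)
    (degree_map_le.trans_lt (degree_lowerPart_lt hh) :
      ((lowerPart d h).map (Int.castRingHom K)).degree < d)
  rw [sum_C_mul_X_pow_eq] at hsum
  simpa only [familyPoly, Polynomial.map_add, Polynomial.map_pow, map_X, monicOfCoeffs, coeff_map,
    eq_intCast, add_right_inj] using hsum

theorem derivCompIterate_familyPoly {K : Type*} [Field K] (d n : ℕ) (h : ℤ[X]) :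
    derivCompIterate ((familyPoly d h).map (Int.castRingHom K)) n =
      C (d : K) * (compIterate (familyPoly d h) (familyDeriv d h) n).map (Int.castRingHom K) := by
  rw [derivCompIterate, derivative_map, derivative_familyPoly, map_compIterate, compIterate,
    Polynomial.map_mul, mul_comp, map_C, C_comp, eq_intCast, Int.cast_natCast]

theorem isSplittingField_of_C_mul {K L : Type*} [Field K] [Field L] [Algebra K L] {a : K}
    (ha : a ≠ 0) {p : K[X]} [IsSplittingField K L (C a * p)] : IsSplittingField K L p where
  splits' := by
    have hsplits := IsSplittingField.splits L (C a * p)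
    rw [Polynomial.map_mul, map_C] at hsplits
    exact (splits_mul_iff_right (C_ne_zero.2 ((_root_.map_ne_zero _).2 ha)) (Splits.C _)).1 hsplits
  adjoin_rootSet' := by
    classical
    rw [← IsSplittingField.adjoin_rootSet L (C a * p), rootSet_def, rootSet_def, aroots_C_mul p ha]

theorem corollary3p6 {K : Type*} [Field K] [NumberField K] (d n : ℕ) (hd : 1 < d) :
    ∃ H : Set (Fin d → K), ZariskiDense H ∧
      ∀ c ∈ H, Nonempty
        ((derivCompIterate (monicOfCoeffs c) n).Gal ≃*
          SymWreath (d - 1) (iteratedSymWreath d n)) := by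
  obtain ⟨N, hN, -, h₀, hd₀, hwitness⟩ :=
    holdsOnResidueClass_hasWitnessPrimes hd (discr_ne_zero K) n 0
  have hd0 : d ≠ 0 := by lia
  refine ⟨_, zariskiDense_lowerPart hd0 hN hd₀, ?_⟩
  rintro _ ⟨h, hh, hhN, rfl⟩
  rw [monicOfCoeffs_lowerPart hh, derivCompIterate_familyPoly]
  set γ := compIterate (familyPoly d h) (familyDeriv d h) n
  set L := (C (d : K) * γ.map (Int.castRingHom K)).SplittingField
  have : NumberField L := NumberField.of_module_finite K L
  have : IsGalois K L := ⟨⟩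
  have : IsSplittingField K L (γ.map (Int.castRingHom K)) :=
    isSplittingField_of_C_mul (Nat.cast_ne_zero.2 hd0 : (d : K) ≠ 0)
  exact nonempty_gal_mulEquiv_symWreath (isMonicPair_family hd hh) (hwitness h hhN)
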